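/- Let $U$ be a finite dimensional complex vector space, $\Bbbk=\mathbb C[[U]]$, and let $n\ge 1$. Let $Q$ be a finite quiver with vertex set $I$ and no edge-loop. Its double $\overline Q$ has an added reverse edge $a^*:j\to i$ for each edge $a:i\to j$ of $Q$, with $(a^*)^*=a$; write $t(a)$ and $h(a)$ for the tail and the head of an edge $a$. Let $B=\bigoplus_{i\in I}\Bbbk e_i$ with the $e_i$ orthogonal idempotents, and let $E$ be the free $\Bbbk$-module on the edges of $\overline Q$, a $B$-bimodule with $a=e_{h(a)}\,a\,e_{t(a)}$. Put $\mathscr B=B^{\otimes n}$ and $\mathscr E=\bigoplus_{\ell=1}^n B^{\otimes(\ell-1)}\otimes E\otimes B^{\otimes(n-\ell)}$. For $\underline i=(i_1,\dots,i_n)\in I^n$ write $|_{\underline i}=e_{i_1}\otimes\cdots\otimes e_{i_n}$, and for $x$ in the path algebra $\Bbbk\overline Q=T_BE$ write $x_\ell|_{\underline i}=e_{i_1}\otimes\cdots\otimes x e_{i_\ell}\otimes\cdots\otimes e_{i_n}$; if $i_\ell=t(a)$, let $a_\ell(\underline i)$ be $\underline i$ with $i_\ell$ replaced by $h(a)$.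 Let $s_{\ell m}\in S_n$ be the transposition of $\ell$ and $m$. For $\lambda=\sum_i\lambda_ie_i\in B$ and $\nu\in\Bbbk$, let $\mathscr A_{n,\lambda,\nu}$ be the quotient of $T_{\mathscr B}\mathscr E\rtimes\Bbbk[S_n]$ by the following relations. (R1) For all $\ell\in[1,n]$ and $\underline i\in I^n$: $$\Big(\sum_{a\in Q}(aa^*-a^*a)-\lambda\Big)_\ell\Big|_{\underline i}=\nu\sum_{m\ne\ell,\ i_m=i_\ell}s_{\ell m}\big|_{\underline i}.$$ (R2) For all $\ell\neq m$ in $[1,n]$, all edges $a,b$ of $\overline Q$ and all $\underline i\in I^n$ with $i_\ell=t(a)$, $i_m=t(b)$: $$a_\ell|_{b_m(\underline i)}\,b_m|_{\underline i}-b_m|_{a_\ell(\underline i)}\,a_\ell|_{\underline i}=\begin{cases}\nu s_{\ell m}|_{\underline i}&\text{if } b\in Q,\ a=b^*,\\ -\nu s_{\ell m}|_{\underline i}&\text{if } a\in Q,\ b=a^*,\\ 0&\text{otherwise.}\end{cases}$$ Let $n=n_1+\cdots+n_r$ with all $n_\ell\ge1$, and let $S_{\vec n}=S_{n_1}\times\cdots\times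 S_{n_r}\subset S_n$ be the corresponding Young subgroup. For each $\ell\in[1,r]$ let $X_\ell$ be a simple $\mathbb C[S_{n_\ell}]$-module, and put $X=X_1\otimes\cdots\otimes X_r$. Let $i_1,\dots,i_r\in I$ be distinct vertices. Write $\overline{\mathscr B}$ for the algebra $\mathscr B$ formed over $\mathbb C$ instead of $\Bbbk$, let $\mathscr N_i$ be the one-dimensional complex vector space placed at the vertex $i$, and let $\mathscr N=\mathscr N_{i_1}^{\otimes n_1}\otimes\cdots\otimes\mathscr N_{i_r}^{\otimes n_r}$. Let $X\otimes\mathscr N\uparrow$ be the $\overline{\mathscr B}\rtimes\mathbb C[S_n]$-module induced from the $\overline{\mathscr B}\rtimes\mathbb C[S_{\vec n}]$-module $X\otimes\mathscr N$. **Theorem.** Assume $\nu\neq0$. The $\mathscr B\rtimes\Bbbk[S_n]$-module $(X\otimes\mathscr N\uparrow)[[U]]$ extends to an $\mathscr A_{n,\lambda,\nu}$-module if and only if the following three conditions hold: (i) for every $\ell\in[1,r]$, the Young diagram of the simple $S_{n_\ell}$-module $X_\ell$ is a rectangle, with $a_\ell$ rows and $b_\ell$ columns (a single row corresponds to the trivial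 module); (ii) no two of the vertices $i_1,\dots,i_r$ are joined by an edge of $Q$; (iii) $\lambda_{i_\ell}=(a_\ell-b_\ell)\nu$ for every $\ell\in[1,r]$. -/

import Mathlib

open scoped TensorProduct

namespace WreathPreproj

universe u v w

noncomputable section

/-! ## Quivers and their doubles -/

section Quiver

variable (I : Type u) [Quiver.{v} I]

/-- The edges of the double quiver `Q̄`: `Sum.inl a` is the edge `a` of `Q`, and `Sum.inr a` is the
added reverse edge `a*`. -/
abbrev DoubleEdge : Type (max u v) := Quiver.Total I ⊕ Quiver.Total I

variable {I}

/-- The tail `t(a)` of an edge of `Q̄`. -/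
def tail : DoubleEdge I → I
  | Sum.inl a => a.left
  | Sum.inr a => a.right

/-- The head `h(a)` of an edge of `Q̄`. -/
def head : DoubleEdge I → I
  | Sum.inl a => a.right
  | Sum.inr a => a.left

/-- The involution `a ↦ a*` of the edges of `Q̄`. -/
def star : DoubleEdge I → DoubleEdge I := Sum.swap

/-- The tuple `a_ℓ(i)`, which is `i` with its `ℓ`-th entry replaced by `h(a)`. -/
def move {n : ℕ} (l : Fin n) (a : DoubleEdge I) (i : Fin n → I) : Fin n → I :=
  Function.update i l (head a)

theorem move_comp_symm {n : ℕ} (σ : Equiv.Perm (Fin n)) (l : Fin n) (a : DoubleEdge I) (i : Fin n → I) :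
    move l a i ∘ σ.symm = move (σ l) a (i ∘ σ.symm) := by
  unfold move
  rw [Function.update_comp_equiv]
  simp

end Quiver

/-! ## The algebra `𝓑 = B^{⊗ n}` and its smash product with a group permuting the factors -/

/-- `𝓑 = B^{⊗ n}` for `B = ⨁_{i ∈ I} k`, with `I` finite: it is the algebra of functions on `I ^ n`,
with `e_{i₁} ⊗ ⋯ ⊗ e_{iₙ}` the indicator function of `(i₁, …, iₙ)`. -/
def BAlg (k : Type w) (I : Type u) (n : ℕ) : Type (max u w) := (Fin n → I) → k

section BAlg

variable (k : Type w) [CommRing k] (I : Type u) (n : ℕ)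

instance : CommRing (BAlg k I n) := inferInstanceAs (CommRing ((Fin n → I) → k))

instance : Algebra k (BAlg k I n) := inferInstanceAs (Algebra k ((Fin n → I) → k))

/-- `S_n` permutes the tensor factors of `𝓑`: `σ (e_i) = e_{i ∘ σ⁻¹}`. -/
instance : MulSemiringAction (Equiv.Perm (Fin n)) (BAlg k I n) where
  smul σ b := fun i => b (i ∘ σ)
  one_smul _ := rfl
  mul_smul _ _ _ := rfl
  smul_zero _ := rfl
  smul_add _ _ _ := rfl
  smul_one _ := rfl
  smul_mul _ _ _ := rfl

variable {k I n}

theorem BAlg.perm_smul_apply (σ : Equiv.Perm (Fin n)) (b : BAlg k I n) (i : Fin n → I) :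
    (σ • b) i = b (i ∘ σ) := rfl

variable (k I n)

instance : SMulCommClass (Equiv.Perm (Fin n)) k (BAlg k I n) where
  smul_comm _ _ _ := rfl

/-- `𝓑 ⋊ k[S_n]`. -/
abbrev BS : Type (max u w) := SkewMonoidAlgebra (BAlg k I n) (Equiv.Perm (Fin n))

end BAlg

/-- The algebra map from `k`-valued functions on a finite set given by a complete system of
orthogonal idempotents `e`. -/
def functionAlgHom {k : Type*} [CommRing k] {J : Type*} [Fintype J] {A : Type*} [Semiring A]
    [Algebra k A] (e : J → A) (idem : ∀ i, e i * e i = e i)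
    (orth : ∀ i j, i ≠ j → e i * e j = 0) (sum_one : ∑ i, e i = 1) : (J → k) →ₐ[k] A :=
  AlgHom.ofLinearMap (Fintype.linearCombination k e)
    (by simp [Fintype.linearCombination_apply, sum_one])
    (by
      intro b c
      simp only [Fintype.linearCombination_apply, Pi.mul_apply]
      rw [Finset.sum_mul]
      refine Finset.sum_congr rfl fun i _ => ?_
      rw [Finset.mul_sum, Finset.sum_eq_single i]
      · rw [smul_mul_smul_comm, idem]
      · intro j _ hj
        rw [smul_mul_smul_comm, orth i j (Ne.symm hj), smul_zero]
      · simp)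

theorem functionAlgHom_apply {k : Type*} [CommRing k] {J : Type*} [Fintype J] {A : Type*}
    [Semiring A] [Algebra k A] (e : J → A) (idem : ∀ i, e i * e i = e i)
    (orth : ∀ i j, i ≠ j → e i * e j = 0) (sum_one : ∑ i, e i = 1) (b : J → k) :
    functionAlgHom e idem orth sum_one b = ∑ i, b i • e i := by
  simp [functionAlgHom, Fintype.linearCombination_apply]

section BAlgLift

variable {k : Type w} [CommRing k] {I : Type u} [Fintype I] {n : ℕ} {A : Type*} [Semiring A]
  [Algebra k A]

/-- The algebra map from `𝓑` given by a complete system of orthogonal idempotents indexed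
by `I ^ n`. -/
def BAlg.lift (e : (Fin n → I) → A) (idem : ∀ i, e i * e i = e i)
    (orth : ∀ i j, i ≠ j → e i * e j = 0) (sum_one : ∑ i, e i = 1) : BAlg k I n →ₐ[k] A :=
  (functionAlgHom e idem orth sum_one : ((Fin n → I) → k) →ₐ[k] A)

theorem BAlg.lift_apply (e : (Fin n → I) → A) (idem : ∀ i, e i * e i = e i)
    (orth : ∀ i j, i ≠ j → e i * e j = 0) (sum_one : ∑ i, e i = 1) (b : BAlg k I n) :
    BAlg.lift e idem orth sum_one b = ∑ i, b i • e i :=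
  functionAlgHom_apply e idem orth sum_one b

end BAlgLift

section Idempotents

variable (k : Type w) [CommRing k] {I : Type u} [DecidableEq I] {n : ℕ}

/-- `e_{i₁} ⊗ ⋯ ⊗ e_{iₙ}` in `𝓑`. -/
def BAlg.idem (i : Fin n → I) : BAlg k I n := Pi.single i (1 : k)

theorem BAlg.idem_apply (i j : Fin n → I) : BAlg.idem k i j = if j = i then 1 else 0 :=
  Pi.single_apply i 1 j

theorem BAlg.idem_mul_self (i : Fin n → I) :
    BAlg.idem k i * BAlg.idem k i = BAlg.idem k i := by
  funext j
  change BAlg.idem k i j * BAlg.idem k i j = BAlg.idem k i j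
  by_cases h : j = i <;> simp [BAlg.idem_apply, h]

theorem BAlg.idem_mul_of_ne (i j : Fin n → I) (h : i ≠ j) :
    BAlg.idem k i * BAlg.idem k j = 0 := by
  funext l
  change BAlg.idem k i l * BAlg.idem k j l = 0
  by_cases hl : l = i
  · subst hl; simp [BAlg.idem_apply, h]
  · simp [BAlg.idem_apply, hl]

theorem BAlg.sum_idem [Fintype I] : ∑ i : Fin n → I, BAlg.idem k i = 1 :=
  Finset.univ_sum_single (fun _ : Fin n → I => (1 : k))

theorem BAlg.perm_smul_idem (σ : Equiv.Perm (Fin n)) (i : Fin n → I) :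
    σ • BAlg.idem k (i ∘ σ) = BAlg.idem k i := by
  funext j
  rw [BAlg.perm_smul_apply, BAlg.idem_apply, BAlg.idem_apply]
  by_cases h : j = i
  · rw [if_pos h, if_pos (by rw [h])]
  · rw [if_neg h, if_neg (fun e => h (σ.surjective.injective_comp_right e))]

end Idempotents

/-- The inclusion of an algebra `A` into its smash product `A ⋊ k[G]`. -/
def smashIncl (k : Type*) [CommSemiring k] (A : Type*) [Semiring A] [Algebra k A] (G : Type*)
    [Monoid G] [MulSemiringAction G A] [SMulCommClass G k A] :
    A →ₐ[k] SkewMonoidAlgebra A G :=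
  AlgHom.ofLinearMap (SkewMonoidAlgebra.lsingle k 1)
    (by rw [SkewMonoidAlgebra.lsingle_apply, SkewMonoidAlgebra.one_def])
    (by
      intro x y
      simp only [SkewMonoidAlgebra.lsingle_apply]
      simp [SkewMonoidAlgebra.single_mul_single])

theorem smashIncl_apply (k : Type*) [CommSemiring k] (A : Type*) [Semiring A] [Algebra k A]
    (G : Type*) [Monoid G] [MulSemiringAction G A] [SMulCommClass G k A] (x : A) :
    smashIncl k A G x = SkewMonoidAlgebra.single 1 x := rfl

/-! ## The tensor algebra `T_𝓑 𝓔` -/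

section TensorAlg

variable (k : Type w) [CommRing k] (I : Type u) [Quiver.{v} I] (n : ℕ)

/-- Generators of `T_𝓑 𝓔` over `k`: `vertex i` is `e_{i₁} ⊗ ⋯ ⊗ e_{iₙ}`, and `edge ℓ a i` is
`a_ℓ|_i = e_{i₁} ⊗ ⋯ ⊗ a e_{i_ℓ} ⊗ ⋯ ⊗ e_{iₙ}`. -/
inductive TGen : Type (max u v)
  | vertex (i : Fin n → I)
  | edge (l : Fin n) (a : DoubleEdge I) (i : Fin n → I)

variable {I n} in
/-- The generator `e_{i₁} ⊗ ⋯ ⊗ e_{iₙ}` in the free algebra. -/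
def freeVertex (i : Fin n → I) : FreeAlgebra k (TGen I n) := FreeAlgebra.ι k (TGen.vertex i)

variable {I n} in
/-- The generator `a_ℓ|_i` in the free algebra. -/
def freeEdge (l : Fin n) (a : DoubleEdge I) (i : Fin n → I) : FreeAlgebra k (TGen I n) :=
  FreeAlgebra.ι k (TGen.edge l a i)

/-- The relations of `T_𝓑 𝓔`: those of the algebra `𝓑`, and those of the `𝓑`-bimodule `𝓔`, which has
`k`-basis the `a_ℓ|_i` with `i_ℓ = t(a)`, where `𝓑` acts on the right of `a_ℓ|_i` through `i` and on
the left through `a_ℓ(i)`. -/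
inductive TRel [Fintype I] : FreeAlgebra k (TGen I n) → FreeAlgebra k (TGen I n) → Prop
  | vertex_idem (i : Fin n → I) : TRel (freeVertex k i * freeVertex k i) (freeVertex k i)
  | vertex_orth (i j : Fin n → I) (h : i ≠ j) : TRel (freeVertex k i * freeVertex k j) 0
  | vertex_sum : TRel (∑ i : Fin n → I, freeVertex k i) 1
  | edge_right (l : Fin n) (a : DoubleEdge I) (i : Fin n → I) :
      TRel (freeEdge k l a i * freeVertex k i) (freeEdge k l a i)
  | edge_left (l : Fin n) (a : DoubleEdge I) (i : Fin n → I) (h : i l = tail a) :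
      TRel (freeVertex k (move l a i) * freeEdge k l a i) (freeEdge k l a i)
  | edge_zero (l : Fin n) (a : DoubleEdge I) (i : Fin n → I) (h : i l ≠ tail a) :
      TRel (freeEdge k l a i) 0

variable [Fintype I]

/-- The tensor algebra `T_𝓑 𝓔`. -/
def TAlg : Type (max u v w) := RingQuot (TRel k I n)

instance : Ring (TAlg k I n) := inferInstanceAs (Ring (RingQuot (TRel k I n)))

instance : Algebra k (TAlg k I n) := inferInstanceAs (Algebra k (RingQuot (TRel k I n)))

/-- The projection from the free algebra on the generators to `T_𝓑 𝓔`. -/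
def TAlg.mk : FreeAlgebra k (TGen I n) →ₐ[k] TAlg k I n := RingQuot.mkAlgHom k (TRel k I n)

variable {k I n}

/-- `e_{i₁} ⊗ ⋯ ⊗ e_{iₙ}` in `T_𝓑 𝓔`. -/
def TAlg.vertex (i : Fin n → I) : TAlg k I n := TAlg.mk k I n (freeVertex k i)

/-- `a_ℓ|_i` in `T_𝓑 𝓔`. -/
def TAlg.edge (l : Fin n) (a : DoubleEdge I) (i : Fin n → I) : TAlg k I n :=
  TAlg.mk k I n (freeEdge k l a i)

theorem TAlg.mk_rel {x y : FreeAlgebra k (TGen I n)} (h : TRel k I n x y) :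
    TAlg.mk k I n x = TAlg.mk k I n y := RingQuot.mkAlgHom_rel k h

theorem TAlg.vertex_idem (i : Fin n → I) :
    (TAlg.vertex i : TAlg k I n) * TAlg.vertex i = TAlg.vertex i := by
  simpa [TAlg.vertex] using TAlg.mk_rel (TRel.vertex_idem (k := k) i)

theorem TAlg.vertex_orth (i j : Fin n → I) (h : i ≠ j) :
    (TAlg.vertex i : TAlg k I n) * TAlg.vertex j = 0 := by
  simpa [TAlg.vertex] using TAlg.mk_rel (TRel.vertex_orth (k := k) i j h)

theorem TAlg.vertex_sum :
    ∑ i : Fin n → I, (TAlg.vertex i : TAlg k I n) = 1 := by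
  simpa [TAlg.vertex] using TAlg.mk_rel (TRel.vertex_sum (k := k) (I := I) (n := n))

theorem TAlg.edge_right (l : Fin n) (a : DoubleEdge I) (i : Fin n → I) :
    (TAlg.edge l a i : TAlg k I n) * TAlg.vertex i = TAlg.edge l a i := by
  simpa [TAlg.vertex, TAlg.edge] using TAlg.mk_rel (TRel.edge_right (k := k) l a i)

theorem TAlg.edge_left (l : Fin n) (a : DoubleEdge I) (i : Fin n → I) (h : i l = tail a) :
    (TAlg.vertex (move l a i) : TAlg k I n) * TAlg.edge l a i = TAlg.edge l a i := by
  simpa [TAlg.vertex, TAlg.edge] using TAlg.mk_rel (TRel.edge_left (k := k) l a i h)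

theorem TAlg.edge_zero (l : Fin n) (a : DoubleEdge I) (i : Fin n → I) (h : i l ≠ tail a) :
    (TAlg.edge l a i : TAlg k I n) = 0 := by
  simpa [TAlg.edge] using TAlg.mk_rel (TRel.edge_zero (k := k) l a i h)

theorem TAlg.algHom_ext {A : Type*} [Semiring A] [Algebra k A] {f g : TAlg k I n →ₐ[k] A}
    (hv : ∀ i, f (TAlg.vertex i) = g (TAlg.vertex i))
    (he : ∀ l a i, f (TAlg.edge l a i) = g (TAlg.edge l a i)) : f = g := by
  refine RingQuot.ringQuot_ext' k f g (FreeAlgebra.hom_ext (funext fun x => ?_))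
  cases x with
  | vertex i => exact hv i
  | edge l a i => exact he l a i

/-- The image of a generator under a permutation of the tensor factors. -/
def permGen (σ : Equiv.Perm (Fin n)) : TGen I n → TAlg k I n
  | TGen.vertex i => TAlg.vertex (i ∘ σ.symm)
  | TGen.edge l a i => TAlg.edge (σ l) a (i ∘ σ.symm)

/-- The automorphism of `T_𝓑 𝓔` given by a permutation of the tensor factors:
`e_i ↦ e_{i ∘ σ⁻¹}` and `a_ℓ|_i ↦ a_{σ(ℓ)}|_{i ∘ σ⁻¹}`. -/
def permT (σ : Equiv.Perm (Fin n)) : TAlg k I n →ₐ[k] TAlg k I n :=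
  RingQuot.liftAlgHom k (s := TRel k I n) ⟨FreeAlgebra.lift k (permGen σ), by
    intro x y h
    cases h with
    | vertex_idem i => simp [freeVertex, permGen, TAlg.vertex_idem]
    | vertex_orth i j h =>
      have h' : i ∘ σ.symm ≠ j ∘ σ.symm := fun e => h (σ.symm.surjective.injective_comp_right e)
      simp [freeVertex, permGen, TAlg.vertex_orth _ _ h']
    | vertex_sum =>
      simp only [freeVertex, map_sum, map_one, FreeAlgebra.lift_ι_apply, permGen]
      rw [← TAlg.vertex_sum (k := k) (I := I) (n := n)]
      exact Equiv.sum_comp (Equiv.arrowCongr σ (Equiv.refl I)) TAlg.vertex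
    | edge_right l a i => simp [freeVertex, freeEdge, permGen, TAlg.edge_right]
    | edge_left l a i h =>
      simp only [freeVertex, freeEdge, map_mul, FreeAlgebra.lift_ι_apply, permGen,
        move_comp_symm]
      exact TAlg.edge_left _ _ _ (by simpa using h)
    | edge_zero l a i h =>
      simp only [freeEdge, map_zero, FreeAlgebra.lift_ι_apply, permGen]
      exact TAlg.edge_zero _ _ _ (by simpa using h)⟩

theorem permT_mk_ι (σ : Equiv.Perm (Fin n)) (x : TGen I n) :
    permT (k := k) σ (TAlg.mk k I n (FreeAlgebra.ι k x)) = permGen σ x := by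
  unfold permT TAlg.mk
  erw [RingQuot.liftAlgHom_mkAlgHom_apply]
  simp

theorem permT_vertex (σ : Equiv.Perm (Fin n)) (i : Fin n → I) :
    permT (k := k) σ (TAlg.vertex i) = TAlg.vertex (i ∘ σ.symm) := permT_mk_ι σ _

theorem permT_edge (σ : Equiv.Perm (Fin n)) (l : Fin n) (a : DoubleEdge I) (i : Fin n → I) :
    permT (k := k) σ (TAlg.edge l a i) = TAlg.edge (σ l) a (i ∘ σ.symm) := permT_mk_ι σ _

theorem permT_one : permT (1 : Equiv.Perm (Fin n)) = AlgHom.id k (TAlg k I n) :=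
  TAlg.algHom_ext (fun i => by rw [permT_vertex]; rfl) (fun l a i => by rw [permT_edge]; rfl)

theorem permT_mul (σ τ : Equiv.Perm (Fin n)) :
    permT (k := k) (I := I) (σ * τ) = (permT σ).comp (permT τ) :=
  TAlg.algHom_ext (fun i => by simp only [AlgHom.comp_apply, permT_vertex]; rfl)
    (fun l a i => by simp only [AlgHom.comp_apply, permT_edge]; rfl)

instance : MulSemiringAction (Equiv.Perm (Fin n)) (TAlg k I n) where
  smul σ x := permT σ x
  one_smul x := by change permT 1 x = x; rw [permT_one]; rfl
  mul_smul σ τ x := by change permT (σ * τ) x = permT σ (permT τ x); rw [permT_mul]; rfl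
  smul_zero σ := map_zero (permT σ)
  smul_add σ := map_add (permT σ)
  smul_one σ := map_one (permT σ)
  smul_mul σ := map_mul (permT σ)

theorem perm_smul_def (σ : Equiv.Perm (Fin n)) (x : TAlg k I n) : σ • x = permT σ x := rfl

instance : SMulCommClass (Equiv.Perm (Fin n)) k (TAlg k I n) where
  smul_comm σ c x := map_smul (permT σ) c x

variable (k I n)

/-- `T_𝓑 𝓔 ⋊ k[S_n]`. -/
abbrev TS : Type (max u v w) := SkewMonoidAlgebra (TAlg k I n) (Equiv.Perm (Fin n))

variable {k I n}

/-- `|_i` in `T_𝓑 𝓔 ⋊ k[S_n]`. -/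
def vert (i : Fin n → I) : TS k I n := SkewMonoidAlgebra.single 1 (TAlg.vertex i)

/-- `a_ℓ|_i` in `T_𝓑 𝓔 ⋊ k[S_n]`. -/
def edge (l : Fin n) (a : DoubleEdge I) (i : Fin n → I) : TS k I n :=
  SkewMonoidAlgebra.single 1 (TAlg.edge l a i)

/-- The group element `σ` in `T_𝓑 𝓔 ⋊ k[S_n]`. -/
def perm (σ : Equiv.Perm (Fin n)) : TS k I n := SkewMonoidAlgebra.of (TAlg k I n) _ σ

/-- The algebra map `𝓑 → T_𝓑 𝓔`. -/
def toTAlg : BAlg k I n →ₐ[k] TAlg k I n :=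
  BAlg.lift TAlg.vertex TAlg.vertex_idem TAlg.vertex_orth TAlg.vertex_sum

theorem toTAlg_smul (σ : Equiv.Perm (Fin n)) (b : BAlg k I n) :
    toTAlg (σ • b) = σ • toTAlg b := by
  unfold toTAlg
  rw [BAlg.lift_apply, BAlg.lift_apply, perm_smul_def, map_sum]
  simp only [map_smul, permT_vertex]
  refine Fintype.sum_equiv (Equiv.arrowCongr σ.symm (Equiv.refl I)) _ _ fun i => ?_
  have : (Equiv.arrowCongr σ.symm (Equiv.refl I)) i ∘ σ.symm = i := by
    ext m; simp [Equiv.arrowCongr]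
  rw [this]
  rfl

/-- The algebra map `𝓑 ⋊ k[S_n] → T_𝓑 𝓔 ⋊ k[S_n]`. -/
def toTS : BS k I n →ₐ[k] TS k I n :=
  SkewMonoidAlgebra.liftNCAlgHom
    ((smashIncl k (TAlg k I n) _).comp toTAlg)
    (SkewMonoidAlgebra.of (TAlg k I n) _)
    (by intro b σ; simp [smashIncl_apply, SkewMonoidAlgebra.single_mul_single, toTAlg_smul])

/-! ## The algebra `𝓐_{n,λ,ν}` -/

variable [DecidableEq I] [Fintype (Quiver.Total I)]

/-- The defining relations of `𝓐_{n,λ,ν}`. The element `(a b)_ℓ|_i`, for edges `a`, `b` of `Q̄`, is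
`a_ℓ|_{b_ℓ(i)} b_ℓ|_i` (both sides are `0` unless `i_ℓ = t(b)`). -/
inductive ARel (lam : I → k) (nu : k) : TS k I n → TS k I n → Prop
  | one_factor (l : Fin n) (i : Fin n → I) :
      ARel lam nu
        ((∑ a : Quiver.Total I,
            (edge l (Sum.inl a) (move l (Sum.inr a) i) * edge l (Sum.inr a) i
              - edge l (Sum.inr a) (move l (Sum.inl a) i) * edge l (Sum.inl a) i))
          - lam (i l) • vert i)
        (nu • ∑ m : Fin n with m ≠ l ∧ i m = i l, perm (Equiv.swap l m) * vert i)
  | two_factors_pos (l m : Fin n) (hlm : l ≠ m) (b : Quiver.Total I) (i : Fin n → I)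
      (hl : i l = tail (star (Sum.inl b))) (hm : i m = tail (Sum.inl b)) :
      ARel lam nu
        (edge l (star (Sum.inl b)) (move m (Sum.inl b) i) * edge m (Sum.inl b) i
          - edge m (Sum.inl b) (move l (star (Sum.inl b)) i) * edge l (star (Sum.inl b)) i)
        (nu • (perm (Equiv.swap l m) * vert i))
  | two_factors_neg (l m : Fin n) (hlm : l ≠ m) (a : Quiver.Total I) (i : Fin n → I)
      (hl : i l = tail (Sum.inl a)) (hm : i m = tail (star (Sum.inl a))) :
      ARel lam nu
        (edge l (Sum.inl a) (move m (star (Sum.inl a)) i) * edge m (star (Sum.inl a)) i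
          - edge m (star (Sum.inl a)) (move l (Sum.inl a) i) * edge l (Sum.inl a) i)
        (-(nu • (perm (Equiv.swap l m) * vert i)))
  | two_factors_zero (l m : Fin n) (hlm : l ≠ m) (a b : DoubleEdge I) (i : Fin n → I)
      (hl : i l = tail a) (hm : i m = tail b) (hab : a ≠ star b) :
      ARel lam nu
        (edge l a (move m b i) * edge m b i - edge m b (move l a i) * edge l a i) 0

/-- The algebra `𝓐_{n,λ,ν}`. -/
def AAlg (n : ℕ) (lam : I → k) (nu : k) : Type (max u v w) :=
  RingQuot (ARel (n := n) lam nu)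

instance (lam : I → k) (nu : k) : Ring (AAlg n lam nu) :=
  inferInstanceAs (Ring (RingQuot (ARel (n := n) lam nu)))

instance (lam : I → k) (nu : k) : Algebra k (AAlg n lam nu) :=
  inferInstanceAs (Algebra k (RingQuot (ARel (n := n) lam nu)))

/-- The projection `T_𝓑 𝓔 ⋊ k[S_n] → 𝓐_{n,λ,ν}`. -/
def AAlg.mk (lam : I → k) (nu : k) : TS k I n →ₐ[k] AAlg n lam nu :=
  RingQuot.mkAlgHom k (ARel (n := n) lam nu)

/-- The structure map `𝓑 ⋊ k[S_n] → 𝓐_{n,λ,ν}`. -/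
def toA (lam : I → k) (nu : k) : BS k I n →ₐ[k] AAlg n lam nu := (AAlg.mk lam nu).comp toTS

end TensorAlg

/-! ## Young subgroups and the induced module `X ⊗ 𝒩 ↑` -/

section Young

variable {n : ℕ} (c : Composition n)

/-- `S_{n₁} × ⋯ × S_{n_r}`. -/
abbrev YoungGroup : Type := ∀ l : Fin c.length, Equiv.Perm (Fin (c.blocksFun l))

/-- The inclusion `S_{n₁} × ⋯ × S_{n_r} ⊂ S_n`, the `ℓ`-th factor permuting the `ℓ`-th block of
consecutive integers. -/
def youngHom : YoungGroup c →* Equiv.Perm (Fin n) :=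
  (c.blocksFinEquiv.permCongrHom : _ →* _).comp (Equiv.Perm.sigmaCongrRightHom _)

theorem index_youngHom (h : YoungGroup c) (m : Fin n) : c.index (youngHom c h m) = c.index m := by
  obtain ⟨⟨l, j⟩, rfl⟩ := c.blocksFinEquiv.surjective m
  change c.index (c.blocksFinEquiv (Equiv.Perm.sigmaCongrRight h
    (c.blocksFinEquiv.symm (c.blocksFinEquiv ⟨l, j⟩)))) = c.index (c.embedding l j)
  rw [Equiv.symm_apply_apply, c.index_embedding]
  exact c.index_embedding l (h l j)

variable {I : Type u}

/-- The tuple `(i₁, …, i₁, i₂, …, i₂, …, i_r, …, i_r)`, with `i_ℓ` repeated `n_ℓ` times. -/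
def baseTuple (vtx : Fin c.length → I) : Fin n → I := fun m => vtx (c.index m)

theorem baseTuple_comp (vtx : Fin c.length → I) (h : YoungGroup c) :
    baseTuple c vtx ∘ youngHom c h = baseTuple c vtx := by
  funext m
  simp [baseTuple, index_youngHom]

/-- The Young subgroup acts on `𝓑` by permuting tensor factors. -/
instance youngAction (k : Type w) [CommRing k] : MulSemiringAction (YoungGroup c) (BAlg k I n) :=
  MulSemiringAction.compHom _ (youngHom c)

theorem young_smul_def (k : Type w) [CommRing k] (h : YoungGroup c) (b : BAlg k I n) :
    h • b = youngHom c h • b := rfl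

instance (k : Type w) [CommRing k] : SMulCommClass (YoungGroup c) k (BAlg k I n) where
  smul_comm _ _ _ := rfl

/-- `𝓑 ⋊ k[S_{n₁} × ⋯ × S_{n_r}]`. -/
abbrev BY (k : Type w) [CommRing k] (I : Type u) {n : ℕ} (c : Composition n) : Type (max u w) :=
  SkewMonoidAlgebra (BAlg k I n) (YoungGroup c)

/-- The inclusion `𝓑 ⋊ k[S_{n₁} × ⋯ × S_{n_r}] → 𝓑 ⋊ k[S_n]`. -/
def BY.toBS (k : Type w) [CommRing k] (I : Type u) {n : ℕ} (c : Composition n) :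
    BY k I c →ₐ[k] BS k I n :=
  SkewMonoidAlgebra.liftNCAlgHom
    (smashIncl k (BAlg k I n) _)
    ((SkewMonoidAlgebra.of (BAlg k I n) _).comp (youngHom c))
    (by intro b h; simp [smashIncl_apply, SkewMonoidAlgebra.single_mul_single, young_smul_def])

variable {c}
variable {X : Fin c.length → Type w} [∀ l, AddCommGroup (X l)] [∀ l, Module ℂ (X l)]

/-- The action of `S_{n₁} × ⋯ × S_{n_r}` on `X = X₁ ⊗ ⋯ ⊗ X_r`. -/
def tensorRep (ρ : ∀ l, Representation ℂ (Equiv.Perm (Fin (c.blocksFun l))) (X l)) :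
    Representation ℂ (YoungGroup c) (⨂[ℂ] l, X l) :=
  PiTensorProduct.mapMonoidHom.comp (MonoidHom.piMap ρ)

/-- The `𝓑 ⋊ ℂ[S_{n₁} × ⋯ × S_{n_r}]`-module `X ⊗ 𝒩`. Since
`𝒩 = 𝒩_{i₁}^{⊗ n₁} ⊗ ⋯ ⊗ 𝒩_{i_r}^{⊗ n_r}` is the one-dimensional space on which `𝓑` acts by evaluation
at the tuple `(i₁, …, i₁, …, i_r, …, i_r)` and on which `S_{n₁} × ⋯ × S_{n_r}`, permuting equal
one-dimensional tensor factors, acts trivially, the underlying space is `X`. -/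
def XN (vtx : Fin c.length → I)
    (ρ : ∀ l, Representation ℂ (Equiv.Perm (Fin (c.blocksFun l))) (X l)) :
    BY ℂ I c →ₐ[ℂ] Module.End ℂ (⨂[ℂ] l, X l) :=
  SkewMonoidAlgebra.liftNCAlgHom
    ((Algebra.ofId ℂ (Module.End ℂ (⨂[ℂ] l, X l))).comp
      (Pi.evalAlgHom ℂ (fun _ : Fin n → I => ℂ) (baseTuple c vtx)))
    (tensorRep ρ)
    (by
      intro b h
      have : (h • b) (baseTuple c vtx) = b (baseTuple c vtx) := by
        rw [young_smul_def, BAlg.perm_smul_apply, baseTuple_comp]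
      change algebraMap ℂ _ ((h • b) (baseTuple c vtx)) * _
        = _ * algebraMap ℂ _ (b (baseTuple c vtx))
      rw [this]
      exact Algebra.commutes _ _)

end Young

/-! ### Induction along an algebra map -/

section Induction

variable {k : Type*} [CommRing k] {S R M : Type*} [Ring S] [Algebra k S] [Ring R] [Algebra k R]
  [AddCommGroup M] [Module k M]

/-- The `R`-submodule of `R ⊗_k M` by which one divides to get `R ⊗_S M`. -/
def balancedRelations (f : S →ₐ[k] R) (π : S →ₐ[k] Module.End k M) : Submodule R (R ⊗[k] M) :=
  Submodule.span R {z | ∃ (r : R) (s : S) (x : M), z = (r * f s) ⊗ₜ[k] x - r ⊗ₜ[k] (π s x)}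

/-- The induced module `R ⊗_S M`, for an algebra map `f : S → R` and an `S`-module `M`. -/
abbrev Ind (f : S →ₐ[k] R) (π : S →ₐ[k] Module.End k M) := (R ⊗[k] M) ⧸ balancedRelations f π

end Induction

section Extension

variable {I : Type u} {n : ℕ} {c : Composition n}
variable {X : Fin c.length → Type w} [∀ l, AddCommGroup (X l)] [∀ l, Module ℂ (X l)]

/-- The `𝓑 ⋊ ℂ[S_n]`-module `X ⊗ 𝒩 ↑`, induced from `X ⊗ 𝒩`. -/
abbrev XNInd (vtx : Fin c.length → I)
    (ρ : ∀ l, Representation ℂ (Equiv.Perm (Fin (c.blocksFun l))) (X l)) : Type (max u w) :=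
  Ind (BY.toBS ℂ I c) (XN vtx ρ)

end Extension

/-! ### Extension of scalars -/

section BaseChange

variable (k : Type*) [CommRing k] [Algebra ℂ k] {I : Type u} [Fintype I] [DecidableEq I] {n : ℕ}
  {M : Type*} [AddCommGroup M] [Module ℂ M]

/-- The `𝓑 ⋊ k[S_n]`-module `k ⊗_ℂ M` obtained from a `𝓑̄ ⋊ ℂ[S_n]`-module `M` (with `𝓑̄` denoting `𝓑`
over `ℂ`) by extension of scalars: the elements `e_{i₁} ⊗ ⋯ ⊗ e_{iₙ}` and `σ ∈ S_n` act by the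
`k`-linear extensions of their actions on `M`. -/
def extendScalars (φ : BS ℂ I n →ₐ[ℂ] Module.End ℂ M) :
    BS k I n →ₐ[k] Module.End k (k ⊗[ℂ] M) :=
  let ψ : BS ℂ I n →ₐ[ℂ] Module.End k (k ⊗[ℂ] M) := (Module.End.baseChangeHom ℂ k M).comp φ
  let ι : BAlg ℂ I n →ₐ[ℂ] BS ℂ I n := smashIncl ℂ (BAlg ℂ I n) _
  SkewMonoidAlgebra.liftNCAlgHom
    (BAlg.lift (fun i : Fin n → I => ψ (ι (BAlg.idem ℂ i)))
      (fun i => by rw [← map_mul, ← map_mul, BAlg.idem_mul_self])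
      (fun i j h => by rw [← map_mul, ← map_mul, BAlg.idem_mul_of_ne ℂ i j h, map_zero, map_zero])
      (by rw [← map_sum, ← map_sum, BAlg.sum_idem, map_one, map_one]))
    ((ψ : BS ℂ I n →* Module.End k (k ⊗[ℂ] M)).comp (SkewMonoidAlgebra.of (BAlg ℂ I n) _))
    (by
      intro b σ
      have key (i : Fin n → I) : ψ (ι (BAlg.idem ℂ i)) * ψ (SkewMonoidAlgebra.of (BAlg ℂ I n) _ σ)
          = ψ (SkewMonoidAlgebra.of (BAlg ℂ I n) _ σ) * ψ (ι (BAlg.idem ℂ (i ∘ σ))) := by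
        rw [← map_mul, ← map_mul]
        congr 1
        simp [ι, smashIncl_apply, SkewMonoidAlgebra.single_mul_single, BAlg.perm_smul_idem]
      rw [BAlg.lift_apply, BAlg.lift_apply, Finset.sum_mul, Finset.mul_sum]
      refine Fintype.sum_equiv (Equiv.arrowCongr σ.symm (Equiv.refl I)) _ _ fun i => ?_
      have hi : (Equiv.arrowCongr σ.symm (Equiv.refl I)) i = i ∘ σ := by
        ext m; simp [Equiv.arrowCongr]
      rw [hi, BAlg.perm_smul_apply, smul_mul_assoc, mul_smul_comm]
      exact congrArg _ (key i))

end BaseChange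

/-! ## Formal power series -/

/-- `ℂ[[U]]`, the formal power series in the coordinates of a basis of `U`. -/
abbrev PowerSeriesOn (U : Type*) [AddCommGroup U] [Module ℂ U] : Type _ :=
  MvPowerSeries (Module.Free.ChooseBasisIndex ℂ U) ℂ

section Extends

variable {I : Type u} [Quiver.{v} I] [Fintype I] [DecidableEq I] [Fintype (Quiver.Total I)]
  {n : ℕ} {c : Composition n} {X : Fin c.length → Type w} [∀ l, AddCommGroup (X l)]
  [∀ l, Module ℂ (X l)]

/-- The `𝓑 ⋊ k[S_n]`-module `(X ⊗ 𝒩 ↑)[[U]]`, for `k = ℂ[[U]]`. As `X ⊗ 𝒩 ↑` is finite dimensional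
for `X` simple, `(X ⊗ 𝒩 ↑)[[U]]` is `ℂ[[U]] ⊗_ℂ (X ⊗ 𝒩 ↑)`. -/
def XNIndSeries (k : Type*) [CommRing k] [Algebra ℂ k] (vtx : Fin c.length → I)
    (ρ : ∀ l, Representation ℂ (Equiv.Perm (Fin (c.blocksFun l))) (X l)) :
    BS k I n →ₐ[k] Module.End k (k ⊗[ℂ] XNInd vtx ρ) :=
  extendScalars k (Algebra.lsmul ℂ ℂ (XNInd vtx ρ))

/-- A `𝓑 ⋊ k[S_n]`-module, given by the algebra map `φ`, extends to an `𝓐_{n,λ,ν}`-module. -/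
def ExtendsToA {k : Type*} [CommRing k] {V : Type*} [AddCommGroup V] [Module k V] (lam : I → k)
    (nu : k) (φ : BS k I n →ₐ[k] Module.End k V) : Prop :=
  ∃ Φ : AAlg n lam nu →ₐ[k] Module.End k V, Φ.comp (toA lam nu) = φ

end Extends

/-! ## Young diagrams of simple modules of symmetric groups -/

section Specht

variable {m : ℕ} {μ : YoungDiagram} (T : Fin m ≃ μ.cells)

open Classical in
/-- The row symmetrizer `∑ σ`, over the permutations preserving the rows of the tableau `T`. -/
def rowSymmetrizer : MonoidAlgebra ℂ (Equiv.Perm (Fin m)) :=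
  ∑ σ : Equiv.Perm (Fin m) with ∀ j, (T (σ j)).1.1 = (T j).1.1, MonoidAlgebra.of ℂ _ σ

open Classical in
/-- The column antisymmetrizer `∑ sgn(σ) σ`, over the permutations preserving the columns of the
tableau `T`. -/
def colAntisymmetrizer : MonoidAlgebra ℂ (Equiv.Perm (Fin m)) :=
  ∑ σ : Equiv.Perm (Fin m) with ∀ j, (T (σ j)).1.2 = (T j).1.2,
    ((Equiv.Perm.sign σ : ℤ) : ℂ) • MonoidAlgebra.of ℂ _ σ

/-- The Specht module `π_μ`: the left ideal of `ℂ[S_m]` generated by the Young symmetrizer of a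
tableau `T` of shape `μ`. -/
def specht : Submodule (MonoidAlgebra ℂ (Equiv.Perm (Fin m)))
    (MonoidAlgebra ℂ (Equiv.Perm (Fin m))) :=
  Submodule.span _ {rowSymmetrizer T * colAntisymmetrizer T}

/-- The representation `ρ` of `S_m` is isomorphic to `π_μ`. (In particular `μ` has `m` cells. A single
row gives the trivial representation.) -/
def HasYoungDiagram {V : Type*} [AddCommGroup V] [Module ℂ V]
    (ρ : Representation ℂ (Equiv.Perm (Fin m)) V) (μ : YoungDiagram) : Prop :=
  ∃ T : Fin m ≃ μ.cells,
    Nonempty (ρ.asModule ≃ₗ[MonoidAlgebra ℂ (Equiv.Perm (Fin m))] specht T)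

/-- The rectangular Young diagram with `a` rows and `b` columns. -/
def rectangle (a b : ℕ) : YoungDiagram where
  cells := Finset.range a ×ˢ Finset.range b
  isLowerSet := by
    intro x y hyx hx
    simp only [Finset.coe_product, Finset.coe_range, Set.mem_prod, Set.mem_Iio] at hx ⊢
    exact ⟨lt_of_le_of_lt hyx.1 hx.1, lt_of_le_of_lt hyx.2 hx.2⟩

end Specht

end

end WreathPreproj

/-! The module lives only at rearrangements of the base tuple. An edge is not a loop, so it changes
how often a vertex occurs in a tuple and must act by zero in every extension. Hence an extension
exists exactly when the defining relations hold with all edges replaced by zero (`extendsToA_iff`).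
Relation (R2) then reads `ν s_{ℓm}|_i = 0` whenever `i_ℓ` and `i_m` are joined by an edge of `Q`; as
`s_{ℓm}` is invertible and `ν ≠ 0`, this is condition (ii). The vertices being distinct, (R1)
involves only transpositions inside one block, and says that on each `X_p` every star sum `∑_{j ≠ l}
s_{lj}` acts by one scalar `c`, with `-λ = cν` at the vertex of the block.

It remains to see that star sums act by a scalar `c` on a simple `S_m`-module exactly when its
diagram is a rectangle, with `c = b - a`. Suppose they do, and take a largest set `D` under which
some nonzero `v` is symmetric. For `j` outside `D` the symmetrization of `v` over `D ∪ {j}` vanishes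
by maximality, so `∑_{l ∈ D} s_{lj} v = -v`. Summing the star sums over `D` gives `|D| c = |D|² -
m`. With `b = |D|`, and with `a` the size of a largest antisymmetric set, `bc = b² - m` and `-ac =
a² - m`, whence `m = ab` and `c = b - a` (`exists_block_sizes`). The same count, repeated on the
remaining points, peels off full rows of length `b`, and likewise full columns of length `a`
(`exists_rows`). Simplicity makes a row-symmetric and a column-antisymmetric vector interact, which
yields a rectangular tableau whose Young symmetrizer does not kill the module
(`exists_rectangular_tableau`), and so an isomorphism with the Specht module
(`hasYoungDiagram_of_ne_zero`).

Conversely, on a rectangular Specht module the star sum at `l` gets `b - 1` from the row of `l` and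
`-1` from each of the other `a - 1` rows (`sum_swap_mul_youngSymmetrizer`). -/

open scoped TensorProduct

namespace WreathPreproj

universe u v w

/-! ### Partial (anti)symmetrization and maximal (anti)symmetric sets. -/

section ScalarAction

open Equiv (swap)

variable {α : Type*} [Fintype α] [DecidableEq α] {V : Type*} [AddCommGroup V] [Module ℂ V]
  (ρ : Representation ℂ (Equiv.Perm α) V)

/-- The transpositions of elements of `D` act on `v` by the scalar `ε`. -/
def SwapFixed (ε : ℂ) (D : Finset α) (v : V) : Prop :=
  ∀ x ∈ D, ∀ y ∈ D, x ≠ y → ρ (swap x y) v = ε • v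

/-- Up to a factor, the (anti)symmetrization over `D ∪ {l}` of a vector that is already
(anti)symmetric under `D`. -/
def garnir (ε : ℂ) (D : Finset α) (l : α) (v : V) : V := v + ε • ∑ j ∈ D, ρ (swap l j) v

omit [Fintype α] in
theorem rep_swap_swap (x y : α) (v : V) : ρ (swap x y) (ρ (swap x y) v) = v := by
  rw [← Module.End.mul_apply, ← map_mul, Equiv.swap_mul_self, map_one, Module.End.one_apply]

omit [Fintype α] in
theorem rep_mul_swap (g : Equiv.Perm α) (x y : α) (v : V) :
    ρ g (ρ (swap x y) v) = ρ (swap (g x) (g y)) (ρ g v) := by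
  rw [← Module.End.mul_apply, ← map_mul, ← Module.End.mul_apply, ← map_mul,
    Equiv.mul_swap_eq_swap_mul]

variable {ρ} {ε : ℂ}

omit [Fintype α] in
theorem rep_swap_garnir_of_notMem {D : Finset α} {l x y : α} {v : V} (hx : x ∉ insert l D)
    (hy : y ∉ insert l D) (hv : ρ (swap x y) v = ε • v) :
    ρ (swap x y) (garnir ρ ε D l v) = ε • garnir ρ ε D l v := by
  simp only [Finset.mem_insert, not_or] at hx hy
  unfold garnir
  rw [map_add, map_smul, map_sum, hv, smul_add]
  congr 1
  congr 1
  rw [Finset.smul_sum]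
  refine Finset.sum_congr rfl fun j hj => ?_
  have hjx : j ≠ x := fun h => hx.2 (h ▸ hj)
  have hjy : j ≠ y := fun h => hy.2 (h ▸ hj)
  rw [rep_mul_swap, Equiv.swap_apply_of_ne_of_ne (Ne.symm hx.1) (Ne.symm hy.1),
    Equiv.swap_apply_of_ne_of_ne hjx hjy, hv, map_smul]

omit [Fintype α] in
-- The transposition `(l y)` exchanges `v` with the summand `j = y`. It fixes each other summand up
-- to `ε`, because `(l y)(l j) = (l j)(y j)` and `(y j)` acts on `v` by `ε`.
theorem SwapFixed.garnir_aux {D : Finset α} {l y : α} {v : V} (hε : ε * ε = 1)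
    (hv : SwapFixed ρ ε D v) (hl : l ∉ D) (hy : y ∈ D) :
    ρ (swap l y) (garnir ρ ε D l v) = ε • garnir ρ ε D l v := by
  unfold garnir
  rw [map_add, map_smul, map_sum, smul_add, smul_smul, hε, one_smul, ← Finset.add_sum_erase _ _ hy,
    rep_swap_swap, ← Finset.add_sum_erase _ _ hy, smul_add, Finset.smul_sum]
  have : ∀ j ∈ D.erase y, ε • ρ (swap l y) (ρ (swap l j) v) = ρ (swap l j) v := by
    intro j hj
    obtain ⟨hjy, hjD⟩ := Finset.mem_erase.mp hj
    have hjl : j ≠ l := fun h => hl (h ▸ hjD)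
    have hyl : y ≠ l := fun h => hl (h ▸ hy)
    have e : swap l y * swap l j = swap l j * swap y j := by
      rw [Equiv.mul_swap_eq_swap_mul, Equiv.swap_apply_left,
        Equiv.swap_apply_of_ne_of_ne hjl hjy, Equiv.mul_swap_eq_swap_mul (swap l j) y j,
        Equiv.swap_apply_right, Equiv.swap_apply_of_ne_of_ne hyl (Ne.symm hjy),
        Equiv.swap_mul_eq_mul_swap, Equiv.swap_inv, Equiv.swap_apply_right,
        Equiv.swap_apply_of_ne_of_ne hjl hjy, Equiv.swap_comm y l]
    rw [← Module.End.mul_apply, ← map_mul, e, map_mul, Module.End.mul_apply,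
      hv y hy j hjD (Ne.symm hjy), map_smul, smul_smul, hε, one_smul]
  rw [Finset.sum_congr rfl this]
  abel

omit [Fintype α] in
theorem SwapFixed.garnir {D : Finset α} {l : α} {v : V} (hε : ε * ε = 1)
    (hv : SwapFixed ρ ε D v) (hl : l ∉ D) :
    SwapFixed ρ ε (insert l D) (garnir ρ ε D l v) := by
  intro x hx y hy hxy
  rcases Finset.mem_insert.mp hx with rfl | hx'
  · exact hv.garnir_aux hε hl ((Finset.mem_insert.mp hy).resolve_left (Ne.symm hxy))
  rcases Finset.mem_insert.mp hy with rfl | hy'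
  · rw [Equiv.swap_comm]
    exact hv.garnir_aux hε hl hx'
  · unfold WreathPreproj.garnir
    rw [map_add, map_smul, map_sum, hv x hx' y hy' hxy, smul_add]
    congr 1
    congr 1
    rw [Finset.smul_sum]
    have hxl : l ≠ x := fun h => hl (h ▸ hx')
    have hyl : l ≠ y := fun h => hl (h ▸ hy')
    refine Finset.sum_bij' (fun j _ => swap x y j) (fun j _ => swap x y j) ?_ ?_ ?_ ?_ ?_
    · intro j hj
      by_cases h1 : j = x
      · subst h1; simpa using hy'
      by_cases h2 : j = y
      · subst h2; simpa using hx'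
      rwa [Equiv.swap_apply_of_ne_of_ne h1 h2]
    · intro j hj
      by_cases h1 : j = x
      · subst h1; simpa using hy'
      by_cases h2 : j = y
      · subst h2; simpa using hx'
      rwa [Equiv.swap_apply_of_ne_of_ne h1 h2]
    · simp
    · simp
    · intro j hj
      rw [rep_mul_swap, Equiv.swap_apply_of_ne_of_ne hxl hyl, hv x hx' y hy' hxy, map_smul]

omit [Fintype α] in
theorem sum_swap_of_garnir_eq_zero {D : Finset α} {l : α} {v : V} (hε : ε * ε = 1)
    (h : WreathPreproj.garnir ρ ε D l v = 0) : ∑ j ∈ D, ρ (swap l j) v = -(ε • v) := by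
  unfold WreathPreproj.garnir at h
  have := congrArg (fun z => ε • z) h
  simp only [smul_add, smul_smul, hε, one_smul, smul_zero] at this
  exact eq_neg_of_add_eq_zero_right this

/-- The vectors on which the transpositions inside the first `k` rows act by `ε`, where `r`
assigns to an element the number of its row. -/
def RowFixed (ρ : Representation ℂ (Equiv.Perm α) V) (ε : ℂ) (r : α → ℕ) (k : ℕ) (v : V) : Prop :=
  ∀ i < k, SwapFixed ρ ε (Finset.univ.filter fun x => r x = i) v

/-- `D` is a largest subset of `E` admitting a nonzero vector that is also fixed by the first `k`
rows. The formula comes from summing the star sums over `l ∈ D`: other points of `D` contribute `ε`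
each, each earlier row contributes `-ε` by `hG`, and points of `E \ D` are handled by maximality. -/
theorem exists_maximal_block {c : ℂ} (hε : ε * ε = 1)
    (hJ : ∀ l v, ∑ j ∈ Finset.univ.erase l, ρ (swap l j) v = c • v) (k : ℕ) (r : α → ℕ)
    (hW : ∃ v ≠ 0, RowFixed ρ ε r k v)
    (hG : ∀ v, RowFixed ρ ε r k v → ∀ i < k, ∀ l, k ≤ r l →
      garnir ρ ε (Finset.univ.filter fun x => r x = i) l v = 0)
    (E : Finset α) (hE : E = Finset.univ.filter fun x => k ≤ r x) (hEn : E.Nonempty) :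
    ∃ D ⊆ E, D.Nonempty ∧ (∃ v ≠ 0, RowFixed ρ ε r k v ∧ SwapFixed ρ ε D v) ∧
      (∀ D' ⊆ E, (∃ v ≠ 0, RowFixed ρ ε r k v ∧ SwapFixed ρ ε D' v) → D'.card ≤ D.card) ∧
      (D.card : ℂ) * (ε * c + k) = (D.card : ℂ) ^ 2 - E.card := by
  classical
  obtain ⟨v₀, hv₀, hv₀W⟩ := hW
  obtain ⟨e₀, he₀⟩ := hEn
  let S := E.powerset.filter fun D => ∃ v ≠ 0, RowFixed ρ ε r k v ∧ SwapFixed ρ ε D v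
  have hS : {e₀} ∈ S := by
    simp only [S, Finset.mem_filter, Finset.mem_powerset, Finset.singleton_subset_iff]
    refine ⟨he₀, v₀, hv₀, hv₀W, ?_⟩
    intro x hx y hy hxy
    rw [Finset.mem_singleton] at hx hy
    exact absurd (hx.trans hy.symm) hxy
  obtain ⟨D, hDS, hDmax⟩ := S.exists_max_image Finset.card ⟨_, hS⟩
  have hDS' := hDS
  simp only [S, Finset.mem_filter, Finset.mem_powerset] at hDS'
  obtain ⟨hDE, v, hv, hvW, hvD⟩ := hDS'
  have hmax : ∀ D' ⊆ E, (∃ v ≠ 0, RowFixed ρ ε r k v ∧ SwapFixed ρ ε D' v) →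
      D'.card ≤ D.card := fun D' h1 h2 =>
    hDmax D' (by simp only [S, Finset.mem_filter, Finset.mem_powerset]; exact ⟨h1, h2⟩)
  refine ⟨D, hDE, ?_, ⟨v, hv, hvW, hvD⟩, hmax, ?_⟩
  · rw [← Finset.card_pos]
    exact lt_of_lt_of_le (by simp) (hDmax _ hS)
  have hmemE : ∀ x, x ∈ E ↔ k ≤ r x := by intro x; simp [hE]
  -- The Garnir vector of `D` and `j` is still fixed by the earlier rows, which are disjoint from `D
  -- ∪ {j}`. If nonzero it would contradict the maximality of `D`.
  have hout : ∀ j ∈ E \ D, ∑ l ∈ D, ρ (swap l j) v = -(ε • v) := by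
    intro j hj
    obtain ⟨hjE, hjD⟩ := Finset.mem_sdiff.mp hj
    have hz : garnir ρ ε D j v = 0 := by
      by_contra hne
      have := hmax (insert j D) (Finset.insert_subset hjE hDE) ⟨_, hne, ?_, hvD.garnir hε hjD⟩
      · rw [Finset.card_insert_of_notMem hjD] at this
        omega
      · intro i hi x hx y hy hxy
        have hnot : ∀ z, r z = i → z ∉ insert j D := by
          intro z hz hmem
          have hzE : z ∈ E := Finset.insert_subset hjE hDE hmem
          rw [hmemE] at hzE
          omega
        exact rep_swap_garnir_of_notMem (hnot x (by simpa using hx)) (hnot y (by simpa using hy))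
          (hvW i hi x hx y hy hxy)
    rw [← sum_swap_of_garnir_eq_zero hε hz]
    exact Finset.sum_congr rfl fun l _ => by rw [Equiv.swap_comm]
  have hrow : ∀ l ∈ D, ∀ i < k, ∑ j with r j = i, ρ (swap l j) v = -(ε • v) := fun l hl i hi =>
    sum_swap_of_garnir_eq_zero hε (hG v hvW i hi l ((hmemE l).mp (hDE hl)))
  have hsplit : ∀ l ∈ D, c • v = ((D.card : ℂ) - 1) • ε • v + ∑ j ∈ E \ D, ρ (swap l j) v
      + (k : ℂ) • (-(ε • v)) := by
    intro l hl
    rw [← hJ l v]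
    have h1 : (Finset.univ.erase l : Finset α)
        = (D.erase l ∪ E \ D) ∪ Finset.univ.filter fun x => r x < k := by
      ext x
      have hlE := hDE hl
      simp only [Finset.mem_erase, Finset.mem_univ, and_true, Finset.mem_union, Finset.mem_sdiff,
        Finset.mem_filter, true_and]
      constructor
      · intro hxl
        by_cases hxD : x ∈ D
        · exact Or.inl (Or.inl ⟨hxl, hxD⟩)
        · by_cases hxE : x ∈ E
          · exact Or.inl (Or.inr ⟨hxE, hxD⟩)
          · exact Or.inr (by by_contra h; exact hxE ((hmemE x).mpr (by omega)))
      · rintro ((⟨h, -⟩ | ⟨-, h⟩) | h) rfl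
        · exact h rfl
        · exact h hl
        · have := (hmemE x).mp hlE
          omega
    rw [h1, Finset.sum_union, Finset.sum_union]
    · congr 1
      · congr 1
        rw [Finset.sum_congr rfl fun j hj => hvD l hl j (Finset.mem_of_mem_erase hj)
          (Finset.ne_of_mem_erase hj).symm, Finset.sum_const, Finset.card_erase_of_mem hl,
          ← Nat.cast_smul_eq_nsmul ℂ, Nat.cast_sub (Finset.card_pos.mpr ⟨l, hl⟩), Nat.cast_one]
      · have h2 : (Finset.univ.filter fun x => r x < k)
            = (Finset.range k).biUnion fun i => Finset.univ.filter fun x => r x = i := by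
          ext x; simp
        rw [h2, Finset.sum_biUnion]
        · rw [Finset.sum_congr rfl fun i hi => hrow l hl i (Finset.mem_range.mp hi),
            Finset.sum_const, Finset.card_range, Nat.cast_smul_eq_nsmul]
        · intro i _ j _ hij
          rw [Function.onFun, Finset.disjoint_left]
          intro x hx hx'
          simp only [Finset.mem_filter, Finset.mem_univ, true_and] at hx hx'
          exact hij (hx.symm.trans hx')
    · rw [Finset.disjoint_left]
      intro x hx hx'
      exact (Finset.mem_sdiff.mp hx').2 (Finset.mem_of_mem_erase hx)
    · rw [Finset.disjoint_left]
      intro x hx hx'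
      have hxE : x ∈ E := by
        rcases Finset.mem_union.mp hx with h | h
        · exact hDE (Finset.mem_of_mem_erase h)
        · exact (Finset.mem_sdiff.mp h).1
      rw [hmemE] at hxE
      simp only [Finset.mem_filter, Finset.mem_univ, true_and] at hx'
      omega
  -- Exchanging the two sums over `D` and `E \ D` brings the cross terms into the form evaluated by
  -- `hout`.
  have hsum := Finset.sum_congr rfl hsplit
  rw [Finset.sum_add_distrib, Finset.sum_add_distrib, Finset.sum_comm, Finset.sum_congr rfl hout]
    at hsum
  simp only [Finset.sum_const, Finset.card_sdiff_of_subset hDE, ← Nat.cast_smul_eq_nsmul ℂ,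
    Nat.cast_sub (Finset.card_le_card hDE)] at hsum
  have hscal : (D.card : ℂ) * c - ((D.card : ℂ) * (D.card - 1) - (E.card - D.card) - D.card * k) * ε
      = 0 := by
    refine (smul_eq_zero.mp ?_).resolve_right hv
    rw [← sub_eq_zero.mpr hsum]
    module
  linear_combination ε * hscal + ((D.card : ℂ) * (D.card - 1) - (E.card - D.card) - D.card * k) * hε

end ScalarAction

/-! ### Sizes of rows and columns forced by scalar star sums. -/

section Blocks

open Equiv (swap)

variable {α : Type*} [Fintype α] [DecidableEq α] {V : Type*} [AddCommGroup V] [Module ℂ V]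
  {ρ : Representation ℂ (Equiv.Perm α) V}

/-- The maximal-block formula with no earlier rows gives `bc = b² - m` for `ε = 1` and `-ac = a² -
m` for `ε = -1`. Eliminating `c` yields `(a + b) m = (a + b) ab`. -/
theorem exists_block_sizes [Nonempty α] [Nontrivial V] {c : ℂ}
    (hJ : ∀ l v, ∑ j ∈ Finset.univ.erase l, ρ (swap l j) v = c • v) :
    ∃ a b : ℕ, Fintype.card α = a * b ∧ c = b - a ∧
      (∀ (D : Finset α) (v : V), v ≠ 0 → SwapFixed ρ 1 D v → D.card ≤ b) ∧
      (∀ (D : Finset α) (v : V), v ≠ 0 → SwapFixed ρ (-1) D v → D.card ≤ a) := by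
  have key : ∀ ε : ℂ, ε * ε = 1 → ∃ d : ℕ, 0 < d ∧
      (∀ (D : Finset α) (v : V), v ≠ 0 → SwapFixed ρ ε D v → D.card ≤ d) ∧
      (d : ℂ) * (ε * c) = (d : ℂ) ^ 2 - Fintype.card α := by
    intro ε hε
    obtain ⟨v, hv⟩ := exists_ne (0 : V)
    obtain ⟨D, -, hD, -, hmax, hcard⟩ := exists_maximal_block (ρ := ρ) hε hJ 0 (fun _ => 0)
      ⟨v, hv, fun i hi => absurd hi (Nat.not_lt_zero i)⟩
      (fun _ _ i hi => absurd hi (Nat.not_lt_zero i)) Finset.univ (by simp) Finset.univ_nonempty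
    refine ⟨D.card, Finset.card_pos.mpr hD, fun D' v' hv' hf => hmax D' (Finset.subset_univ _)
      ⟨v', hv', fun i hi => absurd hi (Nat.not_lt_zero i), hf⟩, ?_⟩
    simpa using hcard
  obtain ⟨b, hb, hbmax, hbc⟩ := key 1 (by norm_num)
  obtain ⟨a, ha, hamax, hac⟩ := key (-1) (by norm_num)
  have ha' : (a : ℂ) ≠ 0 := by exact_mod_cast ha.ne'
  have hb' : (b : ℂ) ≠ 0 := by exact_mod_cast hb.ne'
  have hab : (a : ℂ) + b ≠ 0 := by exact_mod_cast (by omega : a + b ≠ 0)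
  have hm : (Fintype.card α : ℂ) = a * b := by
    refine mul_left_cancel₀ hab ?_
    linear_combination (a : ℂ) * hbc + (b : ℂ) * hac
  refine ⟨a, b, by exact_mod_cast hm, ?_, hbmax, hamax⟩
  refine mul_left_cancel₀ hb' ?_
  linear_combination hbc - hm

/-- Rows are peeled off one at a time. A row already has the largest size `b`, so symmetrizing it
with one more point gives zero, which is the hypothesis needed to apply `exists_maximal_block` to
the remaining points. -/
theorem exists_rowFixed [Nontrivial V] {ε c : ℂ} (hε : ε * ε = 1)
    (hJ : ∀ l v, ∑ j ∈ Finset.univ.erase l, ρ (swap l j) v = c • v) {a b : ℕ}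
    (hcard : Fintype.card α = a * b) (hc : ε * c = b - a)
    (hmax : ∀ (D : Finset α) (v : V), v ≠ 0 → SwapFixed ρ ε D v → D.card ≤ b) (k : ℕ) (hk : k ≤ a) :
    ∃ r : α → ℕ, (∀ i < k, (Finset.univ.filter fun x => r x = i).card = b) ∧ (∀ x, r x ≤ k) ∧
      ∃ v ≠ 0, RowFixed ρ ε r k v := by
  induction k with
  | zero =>
    obtain ⟨v, hv⟩ := exists_ne (0 : V)
    exact ⟨fun _ => 0, by simp, by simp, v, hv, fun i hi => absurd hi (Nat.not_lt_zero i)⟩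
  | succ k ih =>
    obtain ⟨r, hr, hrk, hW⟩ := ih (by omega)
    have hcount : (Finset.univ.filter fun x => k ≤ r x).card + k * b = a * b := by
      rw [← hcard, ← Finset.card_univ,
        ← Finset.card_filter_add_card_filter_not (s := Finset.univ) (fun x => k ≤ r x)]
      congr 1
      have h2 : (Finset.univ.filter fun x => ¬ k ≤ r x)
          = (Finset.range k).biUnion fun i => Finset.univ.filter fun x => r x = i := by
        ext x; simp
      rw [h2, Finset.card_biUnion, Finset.sum_congr rfl fun i hi => hr i (Finset.mem_range.mp hi)]
      · simp
      · intro i _ j _ hij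
        rw [Function.onFun, Finset.disjoint_left]
        intro x hx hx'
        simp only [Finset.mem_filter, Finset.mem_univ, true_and] at hx hx'
        exact hij (hx.symm.trans hx')
    by_cases hb : b = 0
    · subst hb
      obtain ⟨v, hv, -⟩ := hW
      have : IsEmpty α := Fintype.card_eq_zero_iff.mp (by simpa using hcard)
      exact ⟨r, by simp, fun x => (this.false x).elim, v, hv, fun i hi x => (this.false x).elim⟩
    have hEn : (Finset.univ.filter fun x => k ≤ r x).Nonempty := by
      rw [← Finset.card_pos]
      by_contra h
      have h0 : (Finset.univ.filter fun x => k ≤ r x).card = 0 := by omega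
      rw [h0, zero_add] at hcount
      have := Nat.eq_of_mul_eq_mul_right (Nat.pos_of_ne_zero hb) hcount
      omega
    obtain ⟨D, hDE, hD, ⟨v, hv, hvW, hvD⟩, -, hform⟩ := exists_maximal_block (ρ := ρ) hε hJ k r hW
      (by
        intro v hvW i hi l hl
        by_contra hne
        have hln : l ∉ Finset.univ.filter fun x => r x = i := by
          simp only [Finset.mem_filter, Finset.mem_univ, true_and]
          omega
        have := hmax _ _ hne ((hvW i hi).garnir hε hln)
        rw [Finset.card_insert_of_notMem hln, hr i hi] at this
        omega) _ rfl hEn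
    have hDr : ∀ x ∈ D, r x = k := fun x hx =>
      le_antisymm (hrk x) (Finset.mem_filter.mp (hDE hx)).2
    have hDb : D.card = b := by
      have h1 : ((Finset.univ.filter fun x => k ≤ r x).card : ℂ) + k * b = a * b := by
        exact_mod_cast hcount
      rw [hc] at hform
      -- With `|E| = (a - k) b` and `εc = b - a` the quadratic equation for `|D|` factors; the other
      -- root `k - a` is negative.
      have h2 : ((D.card : ℂ) - b) * (D.card + a - k) = 0 := by
        linear_combination -hform + h1
      rcases mul_eq_zero.mp h2 with h | h
      · exact_mod_cast sub_eq_zero.mp h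
      · have h3 : ((D.card + a : ℕ) : ℂ) = (k : ℂ) := by
          push_cast
          linear_combination h
        have h4 : D.card + a = k := by exact_mod_cast h3
        omega
    -- The new row number `k` is kept on `D` only; the points still unassigned move up to `k + 1`.
    have hfib : ∀ i < k, (Finset.univ.filter fun x => (if r x = k ∧ x ∉ D then k + 1 else r x) = i)
        = Finset.univ.filter fun x => r x = i := by
      intro i hi
      ext x
      simp only [Finset.mem_filter, Finset.mem_univ, true_and]
      split_ifs with h <;> omega
    have hfibk : (Finset.univ.filter fun x => (if r x = k ∧ x ∉ D then k + 1 else r x) = k)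
        = D := by
      ext x
      simp only [Finset.mem_filter, Finset.mem_univ, true_and]
      by_cases hx : x ∈ D
      · simp [hx, hDr x hx]
      · by_cases h : r x = k <;> simp [hx, h]
    refine ⟨fun x => if r x = k ∧ x ∉ D then k + 1 else r x, ?_, ?_, v, hv, ?_⟩
    · intro i hi
      rcases Nat.lt_succ_iff_lt_or_eq.mp hi with h | rfl
      · rw [hfib i h, hr i h]
      · rw [hfibk, hDb]
    · intro x
      dsimp only
      have := hrk x
      split_ifs <;> omega
    · intro i hi
      rcases Nat.lt_succ_iff_lt_or_eq.mp hi with h | rfl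
      · rw [hfib i h]
        exact hvW i h
      · rw [hfibk]
        exact hvD

theorem exists_rows [Nontrivial V] {ε c : ℂ} (hε : ε * ε = 1)
    (hJ : ∀ l v, ∑ j ∈ Finset.univ.erase l, ρ (swap l j) v = c • v) {a b : ℕ}
    (hcard : Fintype.card α = a * b) (hc : ε * c = b - a)
    (hmax : ∀ (D : Finset α) (v : V), v ≠ 0 → SwapFixed ρ ε D v → D.card ≤ b) :
    ∃ r : α → ℕ, (∀ x, r x < a) ∧
      ∃ v ≠ 0, ∀ x y, x ≠ y → r x = r y → ρ (swap x y) v = ε • v := by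
  obtain ⟨r, hr, hra, v, hv, hvW⟩ := exists_rowFixed hε hJ hcard hc hmax a le_rfl
  -- The `a` rows of `b` points exhaust all `ab` points, so the leftover value `a` is not taken.
  have hlt : ∀ x, r x < a := by
    intro x
    by_contra h
    have h1 : ((Finset.range a).biUnion fun i => Finset.univ.filter fun x => r x = i).card
        = Fintype.card α := by
      rw [Finset.card_biUnion, Finset.sum_congr rfl fun i hi => hr i (Finset.mem_range.mp hi), hcard]
      · simp
      · intro i _ j _ hij
        rw [Function.onFun, Finset.disjoint_left]
        intro x hx hx'
        simp only [Finset.mem_filter, Finset.mem_univ, true_and] at hx hx'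
        exact hij (hx.symm.trans hx')
    have h2 := (Finset.card_eq_iff_eq_univ _).mp h1
    have h3 := h2 ▸ Finset.mem_univ x
    simp only [Finset.mem_biUnion, Finset.mem_range, Finset.mem_filter, Finset.mem_univ,
      true_and] at h3
    obtain ⟨i, hi, rfl⟩ := h3
    exact h hi
  exact ⟨r, hlt, v, hv, fun x y hxy hr' => hvW (r y) (hlt y) x (by simp [hr']) y (by simp) hxy⟩

/-- A vector transforming by the character `χ` under the transpositions preserving the fibres
of `r` transforms by `χ` under all permutations preserving the fibres. -/
theorem rep_perm_of_swap (χ : Equiv.Perm α →* ℂ) {r : α → ℕ} {v : V}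
    (h : ∀ x y, x ≠ y → r x = r y → ρ (swap x y) v = χ (swap x y) • v) (σ : Equiv.Perm α)
    (hσ : ∀ x, r (σ x) = r x) : ρ σ v = χ σ • v := by
  -- Multiplying `σ` on the left by `swap x (σ x)` shrinks the support and still preserves the
  -- fibres.
  induction hn : σ.support.card using Nat.strong_induction_on generalizing σ with
  | _ n ih =>
    by_cases h1 : σ = 1
    · simp [h1]
    · obtain ⟨x, hx⟩ : ∃ x, σ x ≠ x := by
        by_contra hcon
        push Not at hcon
        exact h1 (Equiv.ext hcon)
      have hlt := Equiv.Perm.card_support_swap_mul hx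
      have hpres : ∀ y, r ((swap x (σ x) * σ) y) = r y := by
        intro y
        rw [Equiv.Perm.mul_apply, ← hσ y]
        by_cases e1 : σ y = x
        · rw [e1, Equiv.swap_apply_left, hσ]
        by_cases e2 : σ y = σ x
        · rw [e2, Equiv.swap_apply_right, hσ]
        · rw [Equiv.swap_apply_of_ne_of_ne e1 e2]
      have hrec := ih _ (hn ▸ hlt) (swap x (σ x) * σ) hpres rfl
      have e : σ = swap x (σ x) * (swap x (σ x) * σ) := by
        rw [← mul_assoc, Equiv.swap_mul_self, one_mul]
      rw [e, map_mul ρ, Module.End.mul_apply, hrec, map_smul, h x (σ x) (Ne.symm hx) (hσ x).symm,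
        smul_smul, mul_comm, ← map_mul]

end Blocks

/-! ### A rectangular tableau from row and column vectors. -/

section Tableau

open Equiv (swap)

variable {m : ℕ} {V : Type*} [AddCommGroup V] [Module ℂ V]
  {ρ : Representation ℂ (Equiv.Perm (Fin m)) V}

open Classical in
theorem asAlgebraHom_rowSymmetrizer {μ : YoungDiagram} (T : Fin m ≃ μ.cells) (v : V) :
    ρ.asAlgebraHom (rowSymmetrizer T) v
      = ∑ σ : Equiv.Perm (Fin m) with ∀ j, (T (σ j)).1.1 = (T j).1.1, ρ σ v := by
  simp [rowSymmetrizer, LinearMap.sum_apply]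

open Classical in
theorem asAlgebraHom_colAntisymmetrizer {μ : YoungDiagram} (T : Fin m ≃ μ.cells) (v : V) :
    ρ.asAlgebraHom (colAntisymmetrizer T) v
      = ∑ σ : Equiv.Perm (Fin m) with ∀ j, (T (σ j)).1.2 = (T j).1.2,
        ((Equiv.Perm.sign σ : ℤ) : ℂ) • ρ σ v := by
  simp [colAntisymmetrizer, LinearMap.sum_apply]

/-- The sign character with values in `ℂ`. -/
noncomputable def signChar (α : Type*) [Fintype α] [DecidableEq α] : Equiv.Perm α →* ℂ :=
  (Int.castRingHom ℂ : ℤ →* ℂ).comp ((Units.coeHom ℤ).comp Equiv.Perm.sign)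

theorem signChar_apply {α : Type*} [Fintype α] [DecidableEq α] (σ : Equiv.Perm α) :
    signChar α σ = ((Equiv.Perm.sign σ : ℤ) : ℂ) := rfl

/-- The row-symmetric `v` and the column-antisymmetric `w` come from unrelated fillings `r` and `s`.
Once `s` is translated by a suitable `g`, the rows of one and the columns of the other meet in
single points and form a tableau. -/
theorem exists_rectangular_tableau (hρ : ρ.IsIrreducible) (hm : 0 < m) {c : ℂ}
    (hJ : ∀ l v, ∑ j ∈ Finset.univ.erase l, ρ (swap l j) v = c • v) :
    ∃ (a b : ℕ) (T : Fin m ≃ (rectangle a b).cells) (u : V), c = b - a ∧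
      ρ.asAlgebraHom (rowSymmetrizer T * colAntisymmetrizer T) u ≠ 0 := by
  classical
  have hsimple : IsSimpleModule (MonoidAlgebra ℂ (Equiv.Perm (Fin m))) ρ.asModule :=
    (Representation.irreducible_iff_isSimpleModule_asModule ρ).mp hρ
  have : Nontrivial V := IsSimpleModule.nontrivial (MonoidAlgebra ℂ (Equiv.Perm (Fin m))) ρ.asModule
  have : Nonempty (Fin m) := ⟨⟨0, hm⟩⟩
  obtain ⟨a, b, hcard, hc, hmaxb, hmaxa⟩ := exists_block_sizes hJ
  obtain ⟨r, hra, v, hv, hvr⟩ := exists_rows (by norm_num) hJ hcard (by rw [hc, one_mul]) hmaxb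
  obtain ⟨s, hsb, w, hw, hws⟩ := exists_rows (ε := -1) (by norm_num) hJ (hcard.trans (mul_comm a b))
    (by rw [hc]; ring) hmaxa
  let R := Finset.univ.filter fun σ : Equiv.Perm (Fin m) => ∀ x, r (σ x) = r x
  have hRv : ∑ σ ∈ R, ρ σ v = (R.card : ℂ) • v := by
    rw [Finset.sum_congr rfl fun σ hσ => rep_perm_of_swap 1 (by simpa using hvr) σ
      (Finset.mem_filter.mp hσ).2]
    simp [Nat.cast_smul_eq_nsmul, R]
  -- By simplicity `v` is a combination of translates of `w`. If row symmetrization killed all of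
  -- these it would kill `v`, which it multiplies by the order of the row group.
  obtain ⟨g, hg⟩ : ∃ g, ∑ σ ∈ R, ρ σ (ρ g w) ≠ 0 := by
    by_contra hcon
    push Not at hcon
    obtain ⟨x, hx⟩ := IsSimpleModule.toSpanSingleton_surjective
      (MonoidAlgebra ℂ (Equiv.Perm (Fin m))) (m := ρ.asModuleEquiv.symm w) (by simpa using hw)
      (ρ.asModuleEquiv.symm v)
    have hx' : ρ.asAlgebraHom x w = v := by
      have := congrArg ρ.asModuleEquiv hx
      rwa [LinearMap.toSpanSingleton_apply, Representation.asModuleEquiv_map_smul,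
        LinearEquiv.apply_symm_apply, LinearEquiv.apply_symm_apply] at this
    have hall : ∀ x : MonoidAlgebra ℂ (Equiv.Perm (Fin m)),
        ∑ σ ∈ R, ρ σ (ρ.asAlgebraHom x w) = 0 := by
      intro x
      induction x using MonoidAlgebra.induction_linear with
      | zero => simp
      | add x y hx hy => simp only [map_add, LinearMap.add_apply, Finset.sum_add_distrib, hx, hy,
          add_zero]
      | single g t =>
        simp only [Representation.asAlgebraHom_single, LinearMap.smul_apply, map_smul,
          ← Finset.smul_sum, hcon, smul_zero]
    have h0 := hall x
    rw [hx', hRv] at h0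
    have hRpos : 0 < R.card := Finset.card_pos.mpr ⟨1, by simp [R]⟩
    exact (smul_ne_zero (by exact_mod_cast hRpos.ne') hv) h0
  have hws' : ∀ x y, x ≠ y → s (g.symm x) = s (g.symm y) →
      ρ (swap x y) (ρ g w) = -(ρ g w) := by
    intro x y hxy hs
    have := rep_mul_swap ρ g (g.symm x) (g.symm y) w
    rw [Equiv.apply_symm_apply, Equiv.apply_symm_apply] at this
    rw [← this, hws _ _ (g.symm.injective.ne hxy) hs, map_smul, neg_one_smul]
  -- A transposition of two points in the same row and the same column is absorbed by the row sum
  -- but negates `ρ g w`, so the row sum would vanish.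
  have hinj : Function.Injective fun x => (r x, s (g.symm x)) := by
    intro x y hxy
    by_contra hne
    obtain ⟨h1, h2⟩ := Prod.mk.inj hxy
    have hsum : ∑ σ ∈ R, ρ σ (ρ (swap x y) (ρ g w)) = ∑ σ ∈ R, ρ σ (ρ g w) := by
      have hsw : ∀ z, r (swap x y z) = r z := by
        intro z
        by_cases e1 : z = x
        · rw [e1, Equiv.swap_apply_left, h1]
        by_cases e2 : z = y
        · rw [e2, Equiv.swap_apply_right, h1]
        · rw [Equiv.swap_apply_of_ne_of_ne e1 e2]
      refine Finset.sum_equiv (Equiv.mulRight (swap x y)) ?_ ?_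
      · intro σ
        simp only [R, Finset.mem_filter, Finset.mem_univ, true_and, Equiv.coe_mulRight,
          Equiv.Perm.mul_apply]
        constructor
        · intro h z
          rw [h, hsw]
        · intro h z
          have := h (swap x y z)
          rwa [Equiv.swap_apply_self, hsw] at this
      · intro σ _
        rw [Equiv.coe_mulRight, map_mul, Module.End.mul_apply]
    rw [hws' x y hne h2] at hsum
    simp only [map_neg, Finset.sum_neg_distrib] at hsum
    refine hg ((smul_eq_zero.mp (?_ : (2 : ℂ) • (∑ σ ∈ R, ρ σ (ρ g w)) = 0)).resolve_left two_ne_zero)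
    rw [two_smul]
    nth_rw 1 [← hsum]
    exact neg_add_cancel _
  have hmem : ∀ x, (r x, s (g.symm x)) ∈ (rectangle a b).cells := fun x => by
    simp [rectangle, hra, hsb]
  let T₀ : Fin m → (rectangle a b).cells := fun x => ⟨(r x, s (g.symm x)), hmem x⟩
  have hT₀ : Function.Bijective T₀ := by
    rw [Fintype.bijective_iff_injective_and_card]
    refine ⟨fun x y h => hinj (congrArg Subtype.val h), ?_⟩
    rw [hcard, Fintype.card_coe]
    simp [rectangle]
  refine ⟨a, b, Equiv.ofBijective T₀ hT₀, ρ g w, hc, ?_⟩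
  have hcol : ρ.asAlgebraHom (colAntisymmetrizer (Equiv.ofBijective T₀ hT₀)) (ρ g w)
      = ((Finset.univ.filter fun σ : Equiv.Perm (Fin m) =>
          ∀ x, s (g.symm (σ x)) = s (g.symm x)).card : ℂ) • ρ g w := by
    rw [asAlgebraHom_colAntisymmetrizer, Finset.sum_congr rfl (g := fun _ => ρ g w),
      Finset.sum_const, Nat.cast_smul_eq_nsmul]
    · rfl
    · intro σ hσ
      rw [rep_perm_of_swap (signChar (Fin m)) (r := fun x => s (g.symm x)) ?_ σ
        (Finset.mem_filter.mp hσ).2, signChar_apply, smul_smul, ← Int.cast_mul, ← Units.val_mul,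
        Int.units_mul_self]
      · simp
      · intro x y hxy h
        rw [hws' x y hxy h, signChar_apply, Equiv.Perm.sign_swap hxy]
        simp
  rw [map_mul, Module.End.mul_apply, hcol, map_smul, asAlgebraHom_rowSymmetrizer]
  refine smul_ne_zero ?_ hg
  have : 0 < (Finset.univ.filter fun σ : Equiv.Perm (Fin m) =>
      ∀ x, s (g.symm (σ x)) = s (g.symm x)).card := Finset.card_pos.mpr ⟨1, by simp⟩
  exact_mod_cast this.ne'

end Tableau

/-! ### Row symmetry and column antisymmetry in the group algebra. -/

section YoungSymmetrizer

open Equiv (swap)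

variable {m : ℕ} {μ : YoungDiagram} (T : Fin m ≃ μ.cells)

/-- `z` is antisymmetric under right multiplication by the column group of `T`. -/
def ColAntisymmetric (z : MonoidAlgebra ℂ (Equiv.Perm (Fin m))) : Prop :=
  ∀ q : Equiv.Perm (Fin m), (∀ j, (T (q j)).1.2 = (T j).1.2) →
    z * MonoidAlgebra.of ℂ _ q = ((Equiv.Perm.sign q : ℤ) : ℂ) • z

/-- `z` is invariant under left multiplication by the row group of `T`. -/
def RowSymmetric (z : MonoidAlgebra ℂ (Equiv.Perm (Fin m))) : Prop :=
  ∀ p : Equiv.Perm (Fin m), (∀ j, (T (p j)).1.1 = (T j).1.1) → MonoidAlgebra.of ℂ _ p * z = z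

theorem rowSymmetric_rowSymmetrizer : RowSymmetric T (rowSymmetrizer T) := by
  classical
  intro p hp
  unfold rowSymmetrizer
  rw [Finset.mul_sum]
  refine Finset.sum_equiv (Equiv.mulLeft p) ?_ ?_
  · intro σ
    simp only [Finset.mem_filter, Finset.mem_univ, true_and, Equiv.coe_mulLeft,
      Equiv.Perm.mul_apply, hp]
  · intro σ _
    rw [Equiv.coe_mulLeft, map_mul]

theorem colAntisymmetric_colAntisymmetrizer : ColAntisymmetric T (colAntisymmetrizer T) := by
  classical
  intro q hq
  unfold colAntisymmetrizer
  rw [Finset.sum_mul, Finset.smul_sum]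
  refine Finset.sum_equiv (Equiv.mulRight q) ?_ ?_
  · intro σ
    simp only [Finset.mem_filter, Finset.mem_univ, true_and, Equiv.coe_mulRight,
      Equiv.Perm.mul_apply]
    constructor
    · intro h j
      rw [h, hq]
    · intro h j
      have h1 := h (q.symm j)
      have h2 := hq (q.symm j)
      rw [Equiv.apply_symm_apply] at h1 h2
      rw [h1, h2]
  · intro σ _
    rw [Equiv.coe_mulRight, map_mul, smul_smul, ← Int.cast_mul, ← Units.val_mul, map_mul,
      mul_comm (Equiv.Perm.sign σ), ← mul_assoc, Int.units_mul_self, one_mul, smul_mul_assoc]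

variable {T}

theorem RowSymmetric.mul_right {z : MonoidAlgebra ℂ (Equiv.Perm (Fin m))} (h : RowSymmetric T z)
    (x : MonoidAlgebra ℂ (Equiv.Perm (Fin m))) : RowSymmetric T (z * x) := fun p hp => by
  rw [← mul_assoc, h p hp]

theorem ColAntisymmetric.mul_left {z : MonoidAlgebra ℂ (Equiv.Perm (Fin m))}
    (h : ColAntisymmetric T z) (x : MonoidAlgebra ℂ (Equiv.Perm (Fin m))) :
    ColAntisymmetric T (x * z) := fun q hq => by
  rw [mul_assoc, h q hq, mul_smul_comm]

theorem swap_preserves {β γ : Type*} [DecidableEq β] (f : β → γ) {x y : β} (h : f x = f y) (z : β) :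
    f (swap x y z) = f z := by
  by_cases e1 : z = x
  · rw [e1, Equiv.swap_apply_left, h]
  by_cases e2 : z = y
  · rw [e2, Equiv.swap_apply_right, h]
  · rw [Equiv.swap_apply_of_ne_of_ne e1 e2]

/-- The coefficient of `g` in `z` vanishes if the transposition of `x` and `y` fixes `z` and
`g⁻¹ x`, `g⁻¹ y` lie in the same column. -/
theorem ColAntisymmetric.coeff_eq_zero {z : MonoidAlgebra ℂ (Equiv.Perm (Fin m))}
    (h : ColAntisymmetric T z) {x y : Fin m} (hxy : x ≠ y)
    (hz : MonoidAlgebra.of ℂ _ (swap x y) * z = z) (g : Equiv.Perm (Fin m))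
    (hcol : (T (g.symm x)).1.2 = (T (g.symm y)).1.2) : z.coeff g = 0 := by
  have h1 := h (swap (g.symm x) (g.symm y)) (swap_preserves (fun j => (T j).1.2) hcol)
  rw [Equiv.Perm.sign_swap (g.symm.injective.ne hxy)] at h1
  have h2 := congrArg (fun w => w.coeff g) h1
  have h3 := congrArg (fun w => w.coeff g) hz
  simp only [MonoidAlgebra.of_apply, MonoidAlgebra.coeff_mul_single_apply,
    MonoidAlgebra.coeff_single_mul_apply, Equiv.swap_inv, mul_one, one_mul] at h2 h3
  -- Both symmetries relate the coefficient of `g` to that of this one element, with opposite signs.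
  have e : g * swap (g.symm x) (g.symm y) = swap x y * g := by
    rw [Equiv.mul_swap_eq_swap_mul, Equiv.apply_symm_apply, Equiv.apply_symm_apply]
  rw [e, h3] at h2
  simp only [Units.val_neg, Units.val_one, Int.cast_neg, Int.cast_one, neg_smul, one_smul,
    MonoidAlgebra.coeff_neg, Finsupp.neg_apply] at h2
  exact self_eq_neg.mp h2

end YoungSymmetrizer

/-! ### Specht modules of rectangular shape. -/

section RectangularSpecht

open Equiv (swap)

variable {m a b : ℕ} {T : Fin m ≃ (rectangle a b).cells}

theorem row_lt (x : Fin m) : (T x).1.1 < a := by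
  have := (T x).2
  simp only [rectangle, Finset.mem_product, Finset.mem_range] at this
  exact this.1

theorem col_lt (x : Fin m) : (T x).1.2 < b := by
  have := (T x).2
  simp only [rectangle, Finset.mem_product, Finset.mem_range] at this
  exact this.2

theorem mem_rectangle {i j : ℕ} (hi : i < a) (hj : j < b) : (i, j) ∈ (rectangle a b).cells := by
  simp [rectangle, hi, hj]

/-- If two points share a row of `T` and their images under `g⁻¹` share a column, the coefficient of
`g` is zero. Otherwise `g = p⁻¹ q` with `p` in the row group and `q` in the column group, and the
coefficient is that of `1` up to sign. -/
theorem eq_zero_of_coeff_one_eq_zero {z : MonoidAlgebra ℂ (Equiv.Perm (Fin m))}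
    (hrow : RowSymmetric T z) (hcol : ColAntisymmetric T z) (h1 : z.coeff 1 = 0) : z = 0 := by
  ext g
  rw [MonoidAlgebra.coeff_zero, Finsupp.zero_apply]
  by_cases hinj : Function.Injective fun x => ((T x).1.1, (T (g.symm x)).1.2)
  · let p₀ : Fin m → Fin m := fun x =>
      T.symm ⟨((T x).1.1, (T (g.symm x)).1.2), mem_rectangle (row_lt x) (col_lt _)⟩
    have hp₀ : Function.Bijective p₀ := by
      rw [← Finite.injective_iff_bijective]
      intro x y hxy
      exact hinj (congrArg Subtype.val (T.symm.injective hxy))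
    let p : Equiv.Perm (Fin m) := Equiv.ofBijective p₀ hp₀
    have hpT : ∀ x, (T (p x)).1 = ((T x).1.1, (T (g.symm x)).1.2) := fun x => by
      simp [p, p₀]
    have hp : ∀ j, (T (p j)).1.1 = (T j).1.1 := fun j => by rw [hpT]
    have hq : ∀ j, (T ((p * g) j)).1.2 = (T j).1.2 := fun j => by
      rw [Equiv.Perm.mul_apply, hpT, Equiv.symm_apply_apply]
    have h2 := congrArg (fun w => w.coeff (p * g)) (hrow p hp)
    have h3 := congrArg (fun w => w.coeff (p * g)) (hcol (p * g) hq)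
    simp only [MonoidAlgebra.of_apply, MonoidAlgebra.coeff_mul_single_apply,
      MonoidAlgebra.coeff_single_mul_apply, mul_one, one_mul, inv_mul_cancel_left, mul_inv_cancel,
      h1, MonoidAlgebra.coeff_smul, Finsupp.smul_apply, smul_eq_mul] at h2 h3
    rw [h2]
    refine (mul_eq_zero.mp h3.symm).resolve_left ?_
    exact_mod_cast (Equiv.Perm.sign (p * g)).ne_zero
  · simp only [Function.Injective, not_forall] at hinj
    obtain ⟨x, y, hxy, hne⟩ := hinj
    obtain ⟨hr, hc⟩ := Prod.mk.inj hxy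
    exact hcol.coeff_eq_zero hne (hrow _ (swap_preserves (fun j => (T j).1.1) hr)) g hc

/-- Pigeonhole: there are only `b` columns, so for every `g` two points of `g⁻¹ D` share one. -/
theorem eq_zero_of_fixed {z : MonoidAlgebra ℂ (Equiv.Perm (Fin m))} (hcol : ColAntisymmetric T z)
    {D : Finset (Fin m)} (hD : b < D.card)
    (hz : ∀ x ∈ D, ∀ y ∈ D, x ≠ y → MonoidAlgebra.of ℂ _ (swap x y) * z = z) : z = 0 := by
  ext g
  rw [MonoidAlgebra.coeff_zero, Finsupp.zero_apply]
  obtain ⟨x, hx, y, hy, hxy, hc⟩ := Finset.exists_ne_map_eq_of_card_lt_of_maps_to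
    (t := Finset.range b) (by simpa using hD) (f := fun x => (T (g.symm x)).1.2)
    (fun x _ => by simpa using col_lt _)
  exact hcol.coeff_eq_zero hxy (hz x hx y hy hxy) g hc

variable (T) in
-- Elements with both symmetries are determined by their coefficient at `1`, so they form at most a
-- line; `e x e` has both.
theorem exists_mul_mul_eq_smul (x : MonoidAlgebra ℂ (Equiv.Perm (Fin m))) :
    ∃ t : ℂ, (rowSymmetrizer T * colAntisymmetrizer T) * x * (rowSymmetrizer T * colAntisymmetrizer T)
      = t • (rowSymmetrizer T * colAntisymmetrizer T) := by
  set e := rowSymmetrizer T * colAntisymmetrizer T with he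
  have hrow : RowSymmetric T e := (rowSymmetric_rowSymmetrizer T).mul_right _
  have hcol : ColAntisymmetric T e := (colAntisymmetric_colAntisymmetrizer T).mul_left _
  by_cases h0 : e = 0
  · exact ⟨0, by rw [h0]; simp⟩
  have h1 : e.coeff 1 ≠ 0 := fun h => h0 (eq_zero_of_coeff_one_eq_zero hrow hcol h)
  have hrow' : RowSymmetric T (e * x * e) := by
    rw [mul_assoc]
    exact hrow.mul_right _
  have hcol' : ColAntisymmetric T (e * x * e) := hcol.mul_left _
  refine ⟨(e * x * e).coeff 1 / e.coeff 1, ?_⟩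
  rw [← sub_eq_zero]
  refine eq_zero_of_coeff_one_eq_zero (T := T) ?_ ?_ ?_
  · intro p hp
    rw [mul_sub, mul_smul_comm, hrow p hp, hrow' p hp]
  · intro q hq
    rw [sub_mul, smul_mul_assoc, hcol q hq, hcol' q hq, smul_sub, smul_comm]
  · rw [MonoidAlgebra.coeff_sub, Finsupp.sub_apply, MonoidAlgebra.coeff_smul, Finsupp.smul_apply,
      smul_eq_mul, div_mul_cancel₀ _ h1, sub_self]

/-- The isomorphism is `x ↦ x • u` on the Specht module. It is onto since the target is simple;
injectivity rests on `e x e` being a multiple of `e`, so simplicity of the Specht module need not be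
known beforehand. -/
theorem hasYoungDiagram_of_ne_zero {V : Type*} [AddCommGroup V] [Module ℂ V]
    {ρ : Representation ℂ (Equiv.Perm (Fin m)) V} (hρ : ρ.IsIrreducible) {u : V}
    (hu : ρ.asAlgebraHom (rowSymmetrizer T * colAntisymmetrizer T) u ≠ 0) :
    HasYoungDiagram ρ (rectangle a b) := by
  have hsimple : IsSimpleModule (MonoidAlgebra ℂ (Equiv.Perm (Fin m))) ρ.asModule :=
    (Representation.irreducible_iff_isSimpleModule_asModule ρ).mp hρ
  set e := rowSymmetrizer T * colAntisymmetrizer T with he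
  let u' : ρ.asModule := ρ.asModuleEquiv.symm u
  have hu' : e • u' ≠ 0 := by
    intro h
    have := congrArg ρ.asModuleEquiv h
    rw [Representation.asModuleEquiv_map_smul] at this
    exact hu (by simpa [u'] using this)
  have heS : e ∈ specht T := Submodule.mem_span_singleton_self _
  let φ := LinearMap.toSpanSingleton (MonoidAlgebra ℂ (Equiv.Perm (Fin m))) ρ.asModule u'
  let f : specht T →ₗ[MonoidAlgebra ℂ (Equiv.Perm (Fin m))] ρ.asModule := φ.comp (specht T).subtype
  have hf : ∀ x : specht T, f x = x.1 • u' := fun x => LinearMap.toSpanSingleton_apply _ _ _ _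
  have hsurj : Function.Surjective f := by
    refine (LinearMap.surjective_or_eq_zero f).resolve_right fun h => hu' ?_
    have := hf ⟨e, heS⟩
    rw [h] at this
    exact this.symm
  have hinj : Function.Injective f := by
    let K : Submodule (MonoidAlgebra ℂ (Equiv.Perm (Fin m))) (MonoidAlgebra ℂ (Equiv.Perm (Fin m))) :=
      specht T ⊓ LinearMap.ker φ
    have hKmem : ∀ x, x ∈ K ↔ x ∈ specht T ∧ x • u' = 0 := fun x => by
      simp [K, φ, Submodule.mem_inf]
    -- By Maschke's theorem the left ideal `K` is a direct summand, so right multiplication by `π 1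
    -- ∈ K` is the identity on `K`. Writing `π 1 = x e`, one gets `e (π 1) = t e`; this kills `u'`
    -- while `e` does not, so `t = 0` and `π 1 = (π 1)² = x (t e) = 0`.
    obtain ⟨π, hπ⟩ := MonoidAlgebra.exists_leftInverse_of_injective K.subtype K.ker_subtype
    have hk : ∀ k ∈ K, k = k * (π 1).1 := by
      intro k hk
      have h1 : π k = ⟨k, hk⟩ := LinearMap.congr_fun hπ ⟨k, hk⟩
      have h2 : π k = k • π 1 := by rw [← map_smul, smul_eq_mul, mul_one]
      have h3 := congrArg Subtype.val (h1.symm.trans h2)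
      simpa using h3
    obtain ⟨hS, hker⟩ := (hKmem _).mp (π 1).2
    obtain ⟨x, hx⟩ := Submodule.mem_span_singleton.mp hS
    rw [smul_eq_mul] at hx
    obtain ⟨t, ht⟩ := exists_mul_mul_eq_smul T x
    rw [← he] at hx ht
    have hek : e * (π 1).1 = t • e := by rw [← hx, ← mul_assoc, ht]
    have ht0 : t = 0 := by
      have h0 : (t • e) • u' = 0 := by rw [← hek, mul_smul, hker, smul_zero]
      rw [smul_assoc] at h0
      exact (smul_eq_zero.mp h0).resolve_right hu'
    have hπ1 : (π 1).1 = 0 := by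
      rw [hk _ (π 1).2]
      nth_rw 1 [← hx]
      rw [mul_assoc, hek, ht0, zero_smul, mul_zero]
    rw [injective_iff_map_eq_zero]
    intro y hy
    apply Subtype.ext
    have := hk y.1 ((hKmem _).mpr ⟨y.2, by rw [← hf, hy]⟩)
    rw [this, hπ1, mul_zero, ZeroMemClass.coe_zero]
  exact ⟨T, ⟨(LinearEquiv.ofBijective f ⟨hinj, hsurj⟩).symm⟩⟩

/-- The representation of the group by left multiplication on its group algebra. -/
noncomputable def leftMulRep (G : Type*) [Group G] : Representation ℂ G (MonoidAlgebra ℂ G) :=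
  (Algebra.lmul ℂ (MonoidAlgebra ℂ G) : MonoidAlgebra ℂ G →* _).comp (MonoidAlgebra.of ℂ G)

theorem leftMulRep_apply {G : Type*} [Group G] (g : G) (x : MonoidAlgebra ℂ G) :
    leftMulRep G g x = MonoidAlgebra.of ℂ G g * x := rfl

theorem card_row (i : ℕ) (hi : i < a) :
    (Finset.univ.filter fun x => (T x).1.1 = i).card = b := by
  refine (Finset.card_bij (t := Finset.range b) (fun x _ => (T x).1.2) ?_ ?_ ?_).trans
    (Finset.card_range b)
  · intro x _
    simpa using col_lt x
  · intro x hx y hy h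
    simp only [Finset.mem_filter, Finset.mem_univ, true_and] at hx hy
    exact T.injective (Subtype.ext (Prod.ext (hx.trans hy.symm) h))
  · intro j hj
    refine ⟨T.symm ⟨(i, j), mem_rectangle hi (by simpa using hj)⟩, ?_, ?_⟩ <;> simp

variable (T) in
-- The row of `l` contributes `b - 1`, by row symmetry. Each of the other `a - 1` rows contributes
-- `-1`, because its Garnir element is symmetric in `b + 1` points on the left and
-- column-antisymmetric on the right, hence zero.
theorem sum_swap_mul_youngSymmetrizer (l : Fin m) :
    ∑ j ∈ Finset.univ.erase l,
        MonoidAlgebra.of ℂ _ (swap l j) * (rowSymmetrizer T * colAntisymmetrizer T)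
      = ((b : ℂ) - a) • (rowSymmetrizer T * colAntisymmetrizer T) := by
  set e := rowSymmetrizer T * colAntisymmetrizer T with he
  have hrow : RowSymmetric T e := (rowSymmetric_rowSymmetrizer T).mul_right _
  have hcol : ColAntisymmetric T e := (colAntisymmetric_colAntisymmetrizer T).mul_left _
  let r : Fin m → ℕ := fun x => (T x).1.1
  have hfix : ∀ i, SwapFixed (leftMulRep _) 1 (Finset.univ.filter fun x => r x = i) e := by
    intro i x hx y hy hxy
    simp only [Finset.mem_filter, Finset.mem_univ, true_and] at hx hy
    rw [leftMulRep_apply, one_smul]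
    exact hrow _ (swap_preserves r (hx.trans hy.symm))
  have hother : ∀ i < a, i ≠ r l → ∑ j with r j = i, MonoidAlgebra.of ℂ _ (swap l j) * e = -e := by
    intro i hi hil
    have hl : l ∉ Finset.univ.filter fun x => r x = i := by simpa using hil.symm
    have hz : garnir (leftMulRep _) 1 (Finset.univ.filter fun x => r x = i) l e = 0 := by
      refine eq_zero_of_fixed (T := T) (D := insert l (Finset.univ.filter fun x => r x = i)) ?_ ?_ ?_
      · intro q hq
        simp only [garnir, leftMulRep_apply, one_smul, add_mul, Finset.sum_mul, smul_add,
          Finset.smul_sum, mul_assoc, hcol q hq, mul_smul_comm]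
      · rw [Finset.card_insert_of_notMem hl, card_row i hi]
        exact Nat.lt_succ_self b
      · intro x hx y hy hxy
        have := (hfix i).garnir (by norm_num) hl x hx y hy hxy
        rwa [leftMulRep_apply, one_smul] at this
    have := sum_swap_of_garnir_eq_zero (by norm_num) hz
    rwa [one_smul] at this
  have hown : ∑ j ∈ (Finset.univ.filter fun x => r x = r l).erase l,
      MonoidAlgebra.of ℂ _ (swap l j) * e = ((b : ℂ) - 1) • e := by
    rw [Finset.sum_congr rfl (g := fun _ => e), Finset.sum_const, Finset.card_erase_of_mem (by simp),
      card_row _ (row_lt l), ← Nat.cast_smul_eq_nsmul ℂ,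
      Nat.cast_sub (Nat.one_le_of_lt (col_lt (T := T) l)), Nat.cast_one]
    intro j hj
    simp only [Finset.mem_erase, Finset.mem_filter, Finset.mem_univ, true_and] at hj
    exact hrow _ (swap_preserves r hj.2.symm)
  have hown' : ∑ j with r j = r l, MonoidAlgebra.of ℂ _ (swap l j) * e = (b : ℂ) • e := by
    rw [← Finset.add_sum_erase _ _ (by simp : l ∈ Finset.univ.filter fun x => r x = r l), hown,
      Equiv.swap_self]
    change MonoidAlgebra.of ℂ _ 1 * e + _ = _
    rw [map_one, one_mul]
    module
  have hall : ∑ j, MonoidAlgebra.of ℂ _ (swap l j) * e = ((b : ℂ) - a + 1) • e := by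
    have hU : (Finset.univ : Finset (Fin m))
        = (Finset.range a).biUnion fun i => Finset.univ.filter fun x => r x = i := by
      ext x
      simpa using row_lt x
    rw [hU, Finset.sum_biUnion, ← Finset.add_sum_erase _ _ (Finset.mem_range.mpr (row_lt (T := T) l)),
      hown', Finset.sum_congr rfl (g := fun _ => -e), Finset.sum_const,
      Finset.card_erase_of_mem (Finset.mem_range.mpr (row_lt (T := T) l)), Finset.card_range,
      ← Nat.cast_smul_eq_nsmul ℂ, Nat.cast_sub (Nat.one_le_of_lt (row_lt (T := T) l)), Nat.cast_one]
    · module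
    · intro i hi
      rw [Finset.mem_erase, Finset.mem_range] at hi
      exact hother i hi.2 hi.1
    · intro i _ j _ hij
      rw [Function.onFun, Finset.disjoint_left]
      intro x hx hx'
      simp only [Finset.mem_filter, Finset.mem_univ, true_and] at hx hx'
      exact hij (hx.symm.trans hx')
  rw [← Finset.add_sum_erase _ _ (Finset.mem_univ l), Equiv.swap_self] at hall
  change MonoidAlgebra.of ℂ _ 1 * e + _ = _ at hall
  rw [map_one, one_mul] at hall
  rw [eq_sub_of_add_eq' hall]
  module

/-- Moving a star sum past `g` turns the star at `l` into the star at `g⁻¹ l`. As the scalar does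
not depend on the point, it passes from `e` to the whole left ideal generated by `e`. -/
theorem sum_swap_apply_of_hasYoungDiagram {V : Type*} [AddCommGroup V] [Module ℂ V]
    {ρ : Representation ℂ (Equiv.Perm (Fin m)) V} (h : HasYoungDiagram ρ (rectangle a b))
    (l : Fin m) (v : V) : ∑ j ∈ Finset.univ.erase l, ρ (swap l j) v = ((b : ℂ) - a) • v := by
  obtain ⟨T, ⟨f⟩⟩ := h
  have key : ∀ (x : MonoidAlgebra ℂ (Equiv.Perm (Fin m))) (l : Fin m),
      ∑ j ∈ Finset.univ.erase l, MonoidAlgebra.of ℂ _ (swap l j) *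
        (x * (rowSymmetrizer T * colAntisymmetrizer T))
      = ((b : ℂ) - a) • (x * (rowSymmetrizer T * colAntisymmetrizer T)) := by
    intro x l
    induction x using MonoidAlgebra.induction_linear with
    | zero => simp
    | add x y hx hy => simp only [add_mul, mul_add, Finset.sum_add_distrib, hx, hy, smul_add]
    | single g t =>
      rw [← mul_smul_comm, ← sum_swap_mul_youngSymmetrizer T (g.symm l), Finset.mul_sum]
      refine Finset.sum_equiv g.symm ?_ ?_
      · intro j
        simp
      · intro j _
        generalize rowSymmetrizer T * colAntisymmetrizer T = e
        rw [← mul_assoc, ← mul_assoc]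
        congr 1
        rw [MonoidAlgebra.of_apply, MonoidAlgebra.of_apply, MonoidAlgebra.single_mul_single,
          MonoidAlgebra.single_mul_single, Equiv.mul_swap_eq_swap_mul, Equiv.apply_symm_apply,
          Equiv.apply_symm_apply, one_mul, mul_one]
  obtain ⟨x, hx⟩ := Submodule.mem_span_singleton.mp (f (ρ.asModuleEquiv.symm v)).2
  rw [smul_eq_mul] at hx
  have h1 := key x l
  rw [hx] at h1
  have h2 : ∑ j ∈ Finset.univ.erase l, MonoidAlgebra.of ℂ _ (swap l j) • ρ.asModuleEquiv.symm v
      = algebraMap ℂ (MonoidAlgebra ℂ (Equiv.Perm (Fin m))) ((b : ℂ) - a)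
        • ρ.asModuleEquiv.symm v := by
    apply f.injective
    apply Subtype.ext
    rw [map_sum, map_smul]
    simp only [map_smul]
    rw [Submodule.coe_sum, Submodule.coe_smul, smul_eq_mul, ← Algebra.smul_def, ← h1]
    exact Finset.sum_congr rfl fun j _ => rfl
  simp only [← Representation.asModuleEquiv_symm_map_rho,
    ← Representation.asModuleEquiv_symm_map_smul, ← map_sum] at h2
  exact ρ.asModuleEquiv.symm.injective h2

end RectangularSpecht

/-- An irreducible representation of `S_m` on which the sum of the transpositions moving a point
acts by a scalar has a rectangular Young diagram. -/
theorem exists_hasYoungDiagram_rectangle {m : ℕ} (hm : 0 < m) {V : Type*} [AddCommGroup V]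
    [Module ℂ V] {ρ : Representation ℂ (Equiv.Perm (Fin m)) V} (hρ : ρ.IsIrreducible) {c : ℂ}
    (hJ : ∀ l v, ∑ j ∈ Finset.univ.erase l, ρ (Equiv.swap l j) v = c • v) :
    ∃ a b : ℕ, HasYoungDiagram ρ (rectangle a b) ∧ c = b - a := by
  obtain ⟨a, b, T, u, hc, hu⟩ := exists_rectangular_tableau hρ hm hJ
  exact ⟨a, b, hasYoungDiagram_of_ne_zero hρ hu, hc⟩

/-! ### Extensions in which the edges act by zero. -/

section ExtensionCriterion

theorem liftNCAlgHom_single {k G A B : Type*} [CommSemiring k] [Monoid G] [Semiring A]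
    [Algebra k A] [Semiring B] [Algebra k B] [MulSemiringAction G A] [SMulCommClass G k A]
    (f : A →ₐ[k] B) (g : G →* B) (h : ∀ {x y}, (f (y • x)) * g y = (g y) * (f x)) (σ : G) (x : A) :
    SkewMonoidAlgebra.liftNCAlgHom f g h (SkewMonoidAlgebra.single σ x) = f x * g σ :=
  SkewMonoidAlgebra.liftNC_single (f : A →+ B) g σ x

theorem single_eq_mul_of {G A : Type*} [Monoid G] [Semiring A] [MulSemiringAction G A] (σ : G)
    (x : A) : SkewMonoidAlgebra.single σ x
      = SkewMonoidAlgebra.single 1 x * SkewMonoidAlgebra.of A G σ := by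
  simp [SkewMonoidAlgebra.single_mul_single]

variable {k : Type w} [CommRing k] {I : Type u} [DecidableEq I] {n : ℕ}

theorem single_idem_mul_of (σ : Equiv.Perm (Fin n)) (i : Fin n → I) :
    (SkewMonoidAlgebra.single 1 (BAlg.idem k i) : BS k I n) * SkewMonoidAlgebra.of _ _ σ
      = SkewMonoidAlgebra.of _ _ σ * SkewMonoidAlgebra.single 1 (BAlg.idem k (i ∘ σ)) := by
  simp [SkewMonoidAlgebra.single_mul_single, BAlg.perm_smul_idem]

variable [Fintype I]

theorem BAlg.eq_sum_idem (b : BAlg k I n) : b = ∑ i, b i • BAlg.idem k i := by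
  funext j
  have h : ∀ s : Finset (Fin n → I), (∑ i ∈ s, b i • BAlg.idem k i : BAlg k I n) j
      = ∑ i ∈ s, b i * BAlg.idem k i j := by
    intro s
    induction s using Finset.induction_on with
    | empty => rfl
    | insert x s hx ih => rw [Finset.sum_insert hx, Finset.sum_insert hx, ← ih]; rfl
  rw [h]
  rw [Finset.sum_eq_single j]
  · simp [BAlg.idem_apply]
  · intro i _ hij
    simp [BAlg.idem_apply, hij.symm]
  · simp

theorem BAlg.lift_idem {A : Type*} [Semiring A] [Algebra k A] (e : (Fin n → I) → A)
    (idem : ∀ i, e i * e i = e i) (orth : ∀ i j, i ≠ j → e i * e j = 0) (sum_one : ∑ i, e i = 1)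
    (i : Fin n → I) : BAlg.lift e idem orth sum_one (BAlg.idem k i) = e i := by
  rw [BAlg.lift_apply]
  simp [BAlg.idem_apply]

variable [Quiver.{v} I]

omit [DecidableEq I] in
theorem toTS_single (σ : Equiv.Perm (Fin n)) (b : BAlg k I n) :
    toTS (SkewMonoidAlgebra.single σ b)
      = (SkewMonoidAlgebra.single 1 (toTAlg b) : TS k I n) * perm σ := by
  rw [toTS, liftNCAlgHom_single]
  · rfl
  · intro b σ
    simp [smashIncl_apply, SkewMonoidAlgebra.single_mul_single, toTAlg_smul]

theorem toTS_idem (i : Fin n → I) :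
    toTS (SkewMonoidAlgebra.single 1 (BAlg.idem k i)) = (vert i : TS k I n) := by
  rw [toTS_single, perm, map_one, mul_one, toTAlg, BAlg.lift_idem, vert]

omit [DecidableEq I] in
theorem toTS_of (σ : Equiv.Perm (Fin n)) :
    toTS (SkewMonoidAlgebra.of (BAlg k I n) _ σ) = (perm σ : TS k I n) := by
  rw [SkewMonoidAlgebra.of_apply, toTS_single, map_one]
  exact one_mul _

section ZeroLift

variable {A : Type*} [Ring A] [Algebra k A] (φ : BS k I n →ₐ[k] A)

/-- The images of the generators of `T_𝓑 𝓔` when the edges act by zero. -/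
noncomputable def zeroGen : TGen I n → A
  | TGen.vertex i => φ (SkewMonoidAlgebra.single 1 (BAlg.idem k i))
  | TGen.edge _ _ _ => 0

/-- The extension of `φ` to `T_𝓑 𝓔` by zero on the edges. -/
noncomputable def zeroLiftT : TAlg k I n →ₐ[k] A :=
  RingQuot.liftAlgHom k (s := TRel k I n) ⟨FreeAlgebra.lift k (zeroGen φ), by
    intro x y h
    cases h with
    | vertex_idem i =>
      simp only [freeVertex, map_mul, FreeAlgebra.lift_ι_apply, zeroGen]
      rw [← map_mul, SkewMonoidAlgebra.single_mul_single, one_smul, one_mul, BAlg.idem_mul_self]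
    | vertex_orth i j h =>
      simp only [freeVertex, map_mul, FreeAlgebra.lift_ι_apply, zeroGen, map_zero]
      rw [← map_mul, SkewMonoidAlgebra.single_mul_single, one_smul, BAlg.idem_mul_of_ne _ _ _ h,
        SkewMonoidAlgebra.single_zero, map_zero]
    | vertex_sum =>
      simp only [freeVertex, map_sum, map_one, FreeAlgebra.lift_ι_apply, zeroGen]
      rw [← map_sum, ← map_one φ]
      congr 1
      have := map_sum (smashIncl k (BAlg k I n) (Equiv.Perm (Fin n))) (BAlg.idem k)
        (Finset.univ : Finset (Fin n → I))
      rw [BAlg.sum_idem, map_one] at this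
      exact this.symm
    | edge_right l a i => simp [freeVertex, freeEdge, zeroGen]
    | edge_left l a i h => simp [freeVertex, freeEdge, zeroGen]
    | edge_zero l a i h => simp [freeEdge, zeroGen]⟩

theorem zeroLiftT_mk (x : TGen I n) :
    zeroLiftT φ (TAlg.mk k I n (FreeAlgebra.ι k x)) = zeroGen φ x := by
  unfold zeroLiftT TAlg.mk
  erw [RingQuot.liftAlgHom_mkAlgHom_apply]
  simp

theorem zeroLiftT_toTAlg (b : BAlg k I n) :
    zeroLiftT φ (toTAlg b) = φ (SkewMonoidAlgebra.single 1 b) := by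
  have h1 : ∀ i, zeroLiftT φ (TAlg.vertex i) = φ (SkewMonoidAlgebra.single 1 (BAlg.idem k i)) :=
    fun i => zeroLiftT_mk φ (TGen.vertex i)
  have h2 : ∀ b : BAlg k I n, φ (SkewMonoidAlgebra.single 1 b)
      = φ (smashIncl k (BAlg k I n) (Equiv.Perm (Fin n)) b) := fun _ => rfl
  conv_rhs => rw [BAlg.eq_sum_idem b, h2, map_sum, map_sum]
  rw [toTAlg, BAlg.lift_apply, map_sum]
  exact Finset.sum_congr rfl fun i _ => by rw [map_smul, map_smul, map_smul, h1, ← h2]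

theorem zeroLiftT_smul (σ : Equiv.Perm (Fin n)) (x : TAlg k I n) :
    zeroLiftT φ (σ • x) * φ (SkewMonoidAlgebra.of _ _ σ)
      = φ (SkewMonoidAlgebra.of _ _ σ) * zeroLiftT φ x := by
  obtain ⟨y, rfl⟩ := RingQuot.mkAlgHom_surjective k (TRel k I n) x
  change zeroLiftT φ (permT σ (TAlg.mk k I n y)) * _ = _ * zeroLiftT φ (TAlg.mk k I n y)
  induction y using FreeAlgebra.induction with
  | grade0 r => simp only [AlgHom.commutes, Algebra.commutes]
  | grade1 x =>
    rw [permT_mk_ι, zeroLiftT_mk]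
    cases x with
    | vertex i =>
      have := zeroLiftT_mk φ (TGen.vertex (i ∘ σ.symm))
      change zeroLiftT φ (TAlg.mk k I n (FreeAlgebra.ι k (TGen.vertex (i ∘ σ.symm)))) * _ = _
      rw [this]
      simp only [zeroGen]
      rw [← map_mul, ← map_mul, single_idem_mul_of]
      congr 4
      funext j
      simp
    | edge l a i =>
      change zeroLiftT φ (TAlg.mk k I n (FreeAlgebra.ι k (TGen.edge (σ l) a (i ∘ σ.symm)))) * _ = _
      rw [zeroLiftT_mk]
      simp [zeroGen]
  | mul x y hx hy =>
    simp only [map_mul] at hx hy ⊢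
    rw [mul_assoc, hy, ← mul_assoc, hx, mul_assoc]
  | add x y hx hy =>
    simp only [map_add] at hx hy ⊢
    rw [add_mul, mul_add, hx, hy]

/-- The extension of `φ` to `T_𝓑 𝓔 ⋊ k[S_n]` by zero on the edges. -/
noncomputable def zeroLift : TS k I n →ₐ[k] A :=
  SkewMonoidAlgebra.liftNCAlgHom (zeroLiftT φ)
    ((φ : BS k I n →* A).comp (SkewMonoidAlgebra.of (BAlg k I n) _))
    (by intro x σ; exact zeroLiftT_smul φ σ x)

theorem zeroLift_single (σ : Equiv.Perm (Fin n)) (x : TAlg k I n) :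
    zeroLift φ (SkewMonoidAlgebra.single σ x)
      = zeroLiftT φ x * φ (SkewMonoidAlgebra.of _ _ σ) :=
  liftNCAlgHom_single _ _ _ _ _

theorem zeroLift_comp_toTS : (zeroLift φ).comp toTS = φ := by
  apply AlgHom.ext
  intro x
  induction x using SkewMonoidAlgebra.induction_on' with
  | single σ b =>
    rw [AlgHom.comp_apply, toTS_single, map_mul, perm, SkewMonoidAlgebra.of_apply, zeroLift_single,
      zeroLift_single, map_one, map_one, mul_one, map_one, one_mul, zeroLiftT_toTAlg, ← map_mul,
      ← single_eq_mul_of]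
  | add x y hx hy => rw [map_add, map_add, hx, hy]

theorem zeroLift_vert (i : Fin n → I) :
    zeroLift φ (vert i) = φ (SkewMonoidAlgebra.single 1 (BAlg.idem k i)) := by
  rw [← toTS_idem, ← AlgHom.comp_apply, zeroLift_comp_toTS]

theorem zeroLift_perm (σ : Equiv.Perm (Fin n)) :
    zeroLift φ (perm σ) = φ (SkewMonoidAlgebra.of _ _ σ) := by
  rw [← toTS_of, ← AlgHom.comp_apply, zeroLift_comp_toTS]

theorem zeroLift_edge (l : Fin n) (a : DoubleEdge I) (i : Fin n → I) :
    zeroLift φ (edge l a i) = 0 := by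
  rw [edge, zeroLift_single, TAlg.edge, freeEdge, zeroLiftT_mk, zeroGen, zero_mul]

end ZeroLift

variable [Fintype (Quiver.Total I)]

/-- If no edge connects two tuples at which the module `V` is nonzero, then `V` extends to a module
over `𝓐_{n,λ,ν}` iff the defining relations hold with zero in place of the edges. -/
theorem extendsToA_iff {V : Type*} [AddCommGroup V] [Module k V] (lam : I → k) (nu : k)
    (φ : BS k I n →ₐ[k] Module.End k V)
    (hφ : ∀ (l : Fin n) (a : DoubleEdge I) (i : Fin n → I), i l = tail a →
      φ (SkewMonoidAlgebra.single 1 (BAlg.idem k (move l a i))) = 0 ∨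
        φ (SkewMonoidAlgebra.single 1 (BAlg.idem k i)) = 0) :
    ExtendsToA lam nu φ ↔
      (∀ (l : Fin n) (i : Fin n → I),
        -(lam (i l) • φ (SkewMonoidAlgebra.single 1 (BAlg.idem k i)))
          = nu • ∑ m with m ≠ l ∧ i m = i l, φ (SkewMonoidAlgebra.of _ _ (Equiv.swap l m)) *
              φ (SkewMonoidAlgebra.single 1 (BAlg.idem k i))) ∧
      (∀ (l m : Fin n), l ≠ m → ∀ (b : Quiver.Total I) (i : Fin n → I),
        i l = b.right → i m = b.left →
          nu • (φ (SkewMonoidAlgebra.of _ _ (Equiv.swap l m)) *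
            φ (SkewMonoidAlgebra.single 1 (BAlg.idem k i))) = 0) := by
  constructor
  · rintro ⟨Φ, hΦ⟩
    let Ψ : TS k I n →ₐ[k] Module.End k V := Φ.comp (AAlg.mk lam nu)
    have hΨ : ∀ x, Ψ (toTS x) = φ x := fun x => AlgHom.congr_fun hΦ x
    have hrel : ∀ {x y}, ARel lam nu x y → Ψ x = Ψ y := fun h =>
      congrArg Φ (RingQuot.mkAlgHom_rel k h)
    have hv : ∀ i, Ψ (vert i) = φ (SkewMonoidAlgebra.single 1 (BAlg.idem k i)) := fun i => by
      rw [← toTS_idem, hΨ]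
    have hp : ∀ σ, Ψ (perm σ) = φ (SkewMonoidAlgebra.of _ _ σ) := fun σ => by rw [← toTS_of, hΨ]
    -- An edge factors through the idempotents at its two end tuples, and one of them acts by zero.
    have he : ∀ l a i, Ψ (edge l a i) = 0 := by
      intro l a i
      by_cases h : i l = tail a
      · rcases hφ l a i h with h0 | h0
        · have : (edge l a i : TS k I n) = vert (move l a i) * edge l a i := by
            rw [vert, edge, SkewMonoidAlgebra.single_mul_single, one_smul, one_mul,
              TAlg.edge_left l a i h]
          rw [this, map_mul, hv, h0, zero_mul]
        · have : (edge l a i : TS k I n) = edge l a i * vert i := by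
            rw [vert, edge, SkewMonoidAlgebra.single_mul_single, one_smul, one_mul,
              TAlg.edge_right l a i]
          rw [this, map_mul, hv, h0, mul_zero]
      · rw [edge, TAlg.edge_zero l a i h, SkewMonoidAlgebra.single_zero, map_zero]
    constructor
    · intro l i
      have := hrel (ARel.one_factor (lam := lam) (nu := nu) l i)
      simpa only [map_sub, map_sum, map_mul, map_smul, he, hv, hp, mul_zero, sub_zero,
        Finset.sum_const_zero, zero_sub] using this
    · intro l m hlm b i hl hm
      have := hrel (ARel.two_factors_pos (lam := lam) (nu := nu) l m hlm b i hl hm)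
      simpa only [map_sub, map_mul, map_smul, he, hv, hp, mul_zero, sub_zero] using this.symm
  · rintro ⟨h1, h2⟩
    have hrel : ∀ ⦃x y⦄, ARel lam nu x y → zeroLift φ x = zeroLift φ y := by
      intro x y h
      cases h with
      | one_factor l i =>
        simp only [map_sub, map_sum, map_mul, map_smul, zeroLift_edge, zeroLift_vert,
          zeroLift_perm, mul_zero, sub_zero, Finset.sum_const_zero, zero_sub]
        exact h1 l i
      | two_factors_pos l m hlm b i hl hm =>
        simp only [map_sub, map_mul, map_smul, zeroLift_edge, zeroLift_vert,
          zeroLift_perm, mul_zero, sub_zero]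
        exact (h2 l m hlm b i hl hm).symm
      | two_factors_neg l m hlm a i hl hm =>
        simp only [map_sub, map_mul, map_smul, map_neg, zeroLift_edge, zeroLift_vert,
          zeroLift_perm, mul_zero, sub_zero]
        -- With the edges gone, this relation is the positive one with the two positions exchanged.
        rw [Equiv.swap_comm, h2 m l hlm.symm a i hm hl, neg_zero]
      | two_factors_zero l m hlm a b i hl hm hab =>
        simp only [map_sub, map_mul, zeroLift_edge, mul_zero, sub_zero, map_zero]
    refine ⟨RingQuot.liftAlgHom k ⟨zeroLift φ, hrel⟩, ?_⟩
    apply AlgHom.ext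
    intro x
    exact (RingQuot.liftAlgHom_mkAlgHom_apply k _ hrel (toTS x)).trans
      (AlgHom.congr_fun (zeroLift_comp_toTS φ) x)

end ExtensionCriterion

/-! ### Action of idempotents and permutations after extension of scalars. -/

section BaseChangeAction

variable (k : Type*) [CommRing k] [Algebra ℂ k] {I : Type u} [Fintype I] [DecidableEq I] {n : ℕ}
  {M : Type*} [AddCommGroup M] [Module ℂ M] (φ : BS ℂ I n →ₐ[ℂ] Module.End ℂ M)

theorem extendScalars_idem (i : Fin n → I) :
    extendScalars k φ (SkewMonoidAlgebra.single 1 (BAlg.idem k i))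
      = (φ (SkewMonoidAlgebra.single 1 (BAlg.idem ℂ i))).baseChange k := by
  rw [extendScalars]
  refine (SkewMonoidAlgebra.liftNC_single _ _ _ _).trans ?_
  rw [map_one, mul_one]
  generalize_proofs
  exact BAlg.lift_idem _ (by assumption) (by assumption) (by assumption) i

theorem extendScalars_of (σ : Equiv.Perm (Fin n)) :
    extendScalars k φ (SkewMonoidAlgebra.of _ _ σ)
      = (φ (SkewMonoidAlgebra.of _ _ σ)).baseChange k := by
  rw [extendScalars]
  refine (SkewMonoidAlgebra.liftNC_single _ _ _ _).trans ?_
  refine Eq.trans ?_ (one_mul _)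
  refine congrArg (· * Module.End.baseChangeHom ℂ k M (φ (SkewMonoidAlgebra.of _ _ σ))) ?_
  generalize_proofs
  exact map_one (BAlg.lift (fun i => Module.End.baseChangeHom ℂ k M
    (φ (smashIncl ℂ (BAlg ℂ I n) _ (BAlg.idem ℂ i)))) (by assumption) (by assumption) (by assumption))

end BaseChangeAction

/-! ### The induced module and its retraction onto `X`. -/

section Induced

variable {I : Type u} {n : ℕ} {c : Composition n} {X : Fin c.length → Type w}
  [∀ l, AddCommGroup (X l)] [∀ l, Module ℂ (X l)] (vtx : Fin c.length → I)
  (ρ : ∀ l, Representation ℂ (Equiv.Perm (Fin (c.blocksFun l))) (X l))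

theorem youngHom_injective : Function.Injective (youngHom c) :=
  c.blocksFinEquiv.permCongrHom.injective.comp Equiv.Perm.sigmaCongrRightHom_injective

theorem BY.toBS_single (k : Type w) [CommRing k] (h : YoungGroup c) (b : BAlg k I n) :
    BY.toBS k I c (SkewMonoidAlgebra.single h b) = SkewMonoidAlgebra.single (youngHom c h) b := by
  rw [BY.toBS]
  refine (SkewMonoidAlgebra.liftNC_single _ _ _ _).trans ?_
  exact (single_eq_mul_of _ _).symm

theorem XN_single_apply (h : YoungGroup c) (b : BAlg ℂ I n) (x : ⨂[ℂ] l, X l) :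
    XN vtx ρ (SkewMonoidAlgebra.single h b) x = b (baseTuple c vtx) • tensorRep ρ h x := by
  rw [XN]
  exact LinearMap.congr_fun (SkewMonoidAlgebra.liftNC_single _ _ _ _) x

/-- The canonical map from `X ⊗ 𝒩` to the module induced from it. -/
noncomputable def toInd : (⨂[ℂ] l, X l) →ₗ[ℂ] XNInd vtx ρ :=
  ((balancedRelations (BY.toBS ℂ I c) (XN vtx ρ)).mkQ.restrictScalars ℂ) ∘ₗ
    TensorProduct.mk ℂ (BS ℂ I n) (⨂[ℂ] l, X l) 1

theorem smul_toInd (r : BS ℂ I n) (x : ⨂[ℂ] l, X l) :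
    r • toInd vtx ρ x = Submodule.Quotient.mk (r ⊗ₜ[ℂ] x) := by
  change r • Submodule.Quotient.mk ((1 : BS ℂ I n) ⊗ₜ[ℂ] x) = _
  rw [← Submodule.Quotient.mk_smul, TensorProduct.smul_tmul', smul_eq_mul, mul_one]

theorem toBS_smul_toInd (s : BY ℂ I c) (x : ⨂[ℂ] l, X l) :
    BY.toBS ℂ I c s • toInd vtx ρ x = toInd vtx ρ (XN vtx ρ s x) := by
  rw [smul_toInd]
  refine (Submodule.Quotient.eq _).mpr (Submodule.subset_span ⟨1, s, x, ?_⟩)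
  rw [one_mul]
  rfl

theorem of_youngHom_smul_toInd (h : YoungGroup c) (x : ⨂[ℂ] l, X l) :
    SkewMonoidAlgebra.of (BAlg ℂ I n) _ (youngHom c h) • toInd vtx ρ x
      = toInd vtx ρ (tensorRep ρ h x) := by
  rw [SkewMonoidAlgebra.of_apply, ← BY.toBS_single, toBS_smul_toInd, XN_single_apply]
  congr 1
  exact one_smul _ _

theorem single_one_smul_toInd (b : BAlg ℂ I n) (x : ⨂[ℂ] l, X l) :
    (SkewMonoidAlgebra.single 1 b : BS ℂ I n) • toInd vtx ρ x
      = b (baseTuple c vtx) • toInd vtx ρ x := by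
  have := toBS_smul_toInd vtx ρ (SkewMonoidAlgebra.single 1 b) x
  rwa [BY.toBS_single, map_one, XN_single_apply, map_one, Module.End.one_apply, map_smul] at this

/-- An element of `𝓑` moved to the right of `σ` acts on `X ⊗ 𝒩` by a scalar, so the translates `σ X`
already span. -/
theorem induced_induction {P : XNInd vtx ρ → Prop} (zero : P 0)
    (add : ∀ z w, P z → P w → P (z + w))
    (of : ∀ (σ : Equiv.Perm (Fin n)) x,
      P (SkewMonoidAlgebra.of (BAlg ℂ I n) _ σ • toInd vtx ρ x)) (z : XNInd vtx ρ) : P z := by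
  obtain ⟨z, rfl⟩ := Submodule.Quotient.mk_surjective _ z
  induction z using TensorProduct.induction_on with
  | zero => exact zero
  | add z w hz hw => exact add _ _ hz hw
  | tmul r x =>
    induction r using SkewMonoidAlgebra.induction_on' with
    | add r s hr hs =>
      rw [TensorProduct.add_tmul]
      exact add _ _ hr hs
    | single σ b =>
      have e : (SkewMonoidAlgebra.single σ b : BS ℂ I n)
          = SkewMonoidAlgebra.of _ _ σ * SkewMonoidAlgebra.single 1 (σ⁻¹ • b) := by
        simp [SkewMonoidAlgebra.single_mul_single]
      rw [← smul_toInd, e, mul_smul, single_one_smul_toInd, ← map_smul]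
      exact of σ _

/-- The component at the base tuple of an element of `𝓑 ⋊ ℂ[S_n]`, projected to the group algebra of
the Young subgroup and acting on `X`. -/
noncomputable def retractBS : BS ℂ I n →ₗ[ℂ] Module.End ℂ (⨂[ℂ] l, X l) where
  toFun r := ∑ h : YoungGroup c, (r.coeff (youngHom c h) (baseTuple c vtx)) • tensorRep ρ h
  map_add' r s := by
    rw [← Finset.sum_add_distrib]
    refine Finset.sum_congr rfl fun h _ => ?_
    rw [← add_smul, SkewMonoidAlgebra.coeff_add, Finsupp.add_apply]
    rfl
  map_smul' t r := by
    rw [Finset.smul_sum]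
    refine Finset.sum_congr rfl fun h _ => ?_
    rw [smul_smul]
    rfl

theorem retractBS_apply (r : BS ℂ I n) : retractBS vtx ρ r
    = ∑ h : YoungGroup c, (r.coeff (youngHom c h) (baseTuple c vtx)) • tensorRep ρ h := rfl

theorem retractBS_single_youngHom (h : YoungGroup c) (b : BAlg ℂ I n) :
    retractBS vtx ρ (SkewMonoidAlgebra.single (youngHom c h) b)
      = b (baseTuple c vtx) • tensorRep ρ h := by
  rw [retractBS_apply, Finset.sum_eq_single h]
  · rw [SkewMonoidAlgebra.coeff_single, Finsupp.single_eq_same]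
  · intro h' _ hne
    rw [SkewMonoidAlgebra.coeff_single, Finsupp.single_eq_of_ne (youngHom_injective.ne hne)]
    exact zero_smul _ _
  · simp

theorem retractBS_single_of_notMem (σ : Equiv.Perm (Fin n)) (hσ : ∀ h, youngHom c h ≠ σ)
    (b : BAlg ℂ I n) : retractBS vtx ρ (SkewMonoidAlgebra.single σ b) = 0 := by
  rw [retractBS_apply]
  refine Finset.sum_eq_zero fun h _ => ?_
  rw [SkewMonoidAlgebra.coeff_single, Finsupp.single_eq_of_ne (hσ h)]
  exact zero_smul _ _

/-- This right linearity lets the retraction descend to the quotient by the balanced relations. It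
holds because the Young subgroup fixes the base tuple and right multiplication by it preserves its
complement. -/
theorem retractBS_mul_toBS (r : BS ℂ I n) (s : BY ℂ I c) :
    retractBS vtx ρ (r * BY.toBS ℂ I c s) = retractBS vtx ρ r * XN vtx ρ s := by
  induction r using SkewMonoidAlgebra.induction_on' with
  | add r r' hr hr' => rw [add_mul, map_add, hr, hr', map_add, add_mul]
  | single σ b =>
    induction s using SkewMonoidAlgebra.induction_on' with
    | add s s' hs hs' => rw [map_add, mul_add, map_add, hs, hs', map_add, mul_add]
    | single h b' =>
      rw [BY.toBS_single, SkewMonoidAlgebra.single_mul_single]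
      by_cases hσ : ∃ h', youngHom c h' = σ
      · obtain ⟨h', rfl⟩ := hσ
        rw [← map_mul, retractBS_single_youngHom, retractBS_single_youngHom]
        refine LinearMap.ext fun x => ?_
        rw [Module.End.mul_apply, XN_single_apply]
        change (b (baseTuple c vtx) * b' (baseTuple c vtx ∘ youngHom c h')) • tensorRep ρ (h' * h) x
          = b (baseTuple c vtx) • tensorRep ρ h' (b' (baseTuple c vtx) • tensorRep ρ h x)
        rw [baseTuple_comp, map_smul, smul_smul, map_mul, Module.End.mul_apply]
      · push Not at hσ
        rw [retractBS_single_of_notMem vtx ρ σ hσ, zero_mul]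
        refine retractBS_single_of_notMem vtx ρ _ (fun h' hh => hσ (h' * h⁻¹) ?_) _
        rw [map_mul, hh, map_inv, mul_inv_cancel_right]

/-- A retraction of `X ⊗ 𝒩 ↑` onto `X`. -/
noncomputable def retract : XNInd vtx ρ →ₗ[ℂ] ⨂[ℂ] l, X l :=
  ((balancedRelations (BY.toBS ℂ I c) (XN vtx ρ)).restrictScalars ℂ).liftQ
    (TensorProduct.lift (retractBS vtx ρ)) (by
      intro z hz
      -- The relations are spanned under left multiplication, for which the retraction is not
      -- linear; so the claim is proved for all left multiples at once.
      have key : ∀ r : BS ℂ I n, TensorProduct.lift (retractBS vtx ρ) (r • z) = 0 := by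
        refine Submodule.span_induction (p := fun z _ => ∀ r : BS ℂ I n,
          TensorProduct.lift (retractBS vtx ρ) (r • z) = 0) ?_ ?_ ?_ ?_ hz
        · rintro _ ⟨r, s, x, rfl⟩ r'
          rw [smul_sub, TensorProduct.smul_tmul', TensorProduct.smul_tmul', map_sub,
            TensorProduct.lift.tmul, TensorProduct.lift.tmul, smul_eq_mul, smul_eq_mul,
            ← mul_assoc, retractBS_mul_toBS, Module.End.mul_apply, sub_self]
        · intro r
          rw [smul_zero, map_zero]
        · intro z w _ _ hz hw r
          rw [smul_add, map_add, hz, hw, add_zero]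
        · intro r z _ hz r'
          rw [smul_smul, hz]
      simpa using key 1) ∘ₗ
    (Submodule.Quotient.restrictScalarsEquiv ℂ
      (balancedRelations (BY.toBS ℂ I c) (XN vtx ρ))).symm.toLinearMap

/-- Hence `X` embeds in the induced module, and equations there can be tested on `X`. -/
theorem retract_toInd (x : ⨂[ℂ] l, X l) : retract vtx ρ (toInd vtx ρ x) = x := by
  change TensorProduct.lift (retractBS vtx ρ) ((1 : BS ℂ I n) ⊗ₜ[ℂ] x) = x
  rw [TensorProduct.lift.tmul, SkewMonoidAlgebra.one_def, ← map_one (youngHom c),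
    retractBS_single_youngHom, map_one]
  change (1 : ℂ) • x = x
  exact one_smul ℂ x

end Induced

/-! ### Transpositions inside a block. -/

section BlockSwaps

variable {I : Type u} {n : ℕ} {c : Composition n} {X : Fin c.length → Type w}
  [∀ l, AddCommGroup (X l)] [∀ l, Module ℂ (X l)]
  (ρ : ∀ l, Representation ℂ (Equiv.Perm (Fin (c.blocksFun l))) (X l))

theorem youngHom_mulSingle_swap (p : Fin c.length) (j j' : Fin (c.blocksFun p)) :
    youngHom c (Pi.mulSingle p (Equiv.swap j j'))
      = Equiv.swap (c.embedding p j) (c.embedding p j') := by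
  have h1 : Equiv.Perm.sigmaCongrRightHom _ (Pi.mulSingle p (Equiv.swap j j') : YoungGroup c)
      = Equiv.swap (⟨p, j⟩ : Σ l, Fin (c.blocksFun l)) ⟨p, j'⟩ := by
    ext1 ⟨q, i⟩
    change (⟨q, (Pi.mulSingle p (Equiv.swap j j') : YoungGroup c) q i⟩
      : Σ l, Fin (c.blocksFun l)) = _
    by_cases hq : q = p
    · subst hq
      rw [Pi.mulSingle_eq_same]
      by_cases e1 : i = j
      · subst e1; simp
      by_cases e2 : i = j'
      · subst e2; simp
      · rw [Equiv.swap_apply_of_ne_of_ne e1 e2, Equiv.swap_apply_of_ne_of_ne] <;>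
          simpa
    · rw [Pi.mulSingle_eq_of_ne hq, Equiv.swap_apply_of_ne_of_ne]
      · rfl
      · exact fun h => hq (congrArg Sigma.fst h)
      · exact fun h => hq (congrArg Sigma.fst h)
  change c.blocksFinEquiv.permCongr _ = _
  rw [h1]
  exact Equiv.symm_trans_swap_trans _ _ _

theorem tensorRep_mulSingle_tprod (p : Fin c.length) (σ : Equiv.Perm (Fin (c.blocksFun p)))
    (x : ∀ l, X l) :
    tensorRep ρ (Pi.mulSingle p σ) (PiTensorProduct.tprod ℂ x)
      = PiTensorProduct.tprod ℂ (Function.update x p (ρ p σ (x p))) := by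
  change PiTensorProduct.map (fun l => ρ l ((Pi.mulSingle p σ : YoungGroup c) l)) _ = _
  rw [PiTensorProduct.map_tprod]
  congr 1
  funext q
  by_cases hq : q = p
  · subst hq
    simp
  · rw [Pi.mulSingle_eq_of_ne hq, Function.update_of_ne hq, map_one, Module.End.one_apply]

/-- The sum of the transpositions of the `j`-th point of the `p`-th block with the other points of
the block acts on the `p`-th tensor factor. -/
theorem sum_tensorRep_swap_tprod (p : Fin c.length) (j : Fin (c.blocksFun p)) (x : ∀ l, X l) :
    ∑ j' ∈ Finset.univ.erase j,
        tensorRep ρ (Pi.mulSingle p (Equiv.swap j j')) (PiTensorProduct.tprod ℂ x)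
      = PiTensorProduct.tprod ℂ
        (Function.update x p (∑ j' ∈ Finset.univ.erase j, ρ p (Equiv.swap j j') (x p))) := by
  rw [MultilinearMap.map_update_sum]
  exact Finset.sum_congr rfl fun j' _ => tensorRep_mulSingle_tprod ρ p _ x

variable (vtx : Fin c.length → I)

/-- The positions carrying the same vertex as a given one are exactly those of its block, since the
vertices are distinct. -/
theorem sum_block_swaps_smul_toInd [DecidableEq I] (hvtx : Function.Injective vtx)
    (p : Fin c.length) (j : Fin (c.blocksFun p)) (x : ⨂[ℂ] l, X l) :
    ∑ m with m ≠ c.embedding p j ∧ baseTuple c vtx m = baseTuple c vtx (c.embedding p j),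
        SkewMonoidAlgebra.of (BAlg ℂ I n) _ (Equiv.swap (c.embedding p j) m) • toInd vtx ρ x
      = toInd vtx ρ (∑ j' ∈ Finset.univ.erase j,
        tensorRep ρ (Pi.mulSingle p (Equiv.swap j j')) x) := by
  rw [map_sum]
  symm
  refine Finset.sum_bij (fun j' _ => c.embedding p j') ?_ ?_ ?_ ?_
  · intro j' hj'
    simp only [Finset.mem_filter, Finset.mem_univ, true_and]
    refine ⟨(c.embedding p).injective.ne (Finset.ne_of_mem_erase hj'), ?_⟩
    rw [baseTuple, baseTuple, c.index_embedding, c.index_embedding]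
  · intro _ _ _ _ h
    exact (c.embedding p).injective h
  · intro m hm
    simp only [Finset.mem_filter, Finset.mem_univ, true_and, baseTuple, c.index_embedding] at hm
    obtain ⟨hne, hm⟩ := hm
    have hm' := hvtx hm
    subst hm'
    refine ⟨c.invEmbedding m, ?_, c.embedding_comp_inv m⟩
    rw [Finset.mem_erase]
    refine ⟨fun h => hne ?_, Finset.mem_univ _⟩
    rw [← h, c.embedding_comp_inv]
  · intro j' _
    rw [← youngHom_mulSingle_swap, of_youngHom_smul_toInd]

end BlockSwaps

section TensorFunctionals

/-- The product of functionals taking the value `1` on each factor takes the value `1` on the pure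
tensor. -/
theorem tprod_ne_zero {ι K : Type*} [Fintype ι] [Field K] {X : ι → Type*}
    [∀ l, AddCommGroup (X l)] [∀ l, Module K (X l)] {x : ∀ l, X l} (hx : ∀ l, x l ≠ 0) :
    PiTensorProduct.tprod K x ≠ 0 := by
  choose f hf using fun l => Module.Projective.exists_dual_eq_one K (hx l)
  intro h
  have := congrArg (PiTensorProduct.lift
    ((MultilinearMap.mkPiAlgebra K ι K).compLinearMap f)) h
  rw [map_zero, PiTensorProduct.lift.tprod] at this
  simp [hf] at this

end TensorFunctionals

/-! ### The support of the module after extension of scalars. -/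

section Series

variable (k : Type*) [CommRing k] [Algebra ℂ k] {I : Type u} [Fintype I] [DecidableEq I] {n : ℕ}
  {c : Composition n} {X : Fin c.length → Type w}
  [∀ l, AddCommGroup (X l)] [∀ l, Module ℂ (X l)] (vtx : Fin c.length → I)
  (ρ : ∀ l, Representation ℂ (Equiv.Perm (Fin (c.blocksFun l))) (X l))

theorem XNIndSeries_idem_tmul (i : Fin n → I) (t : k) (z : XNInd vtx ρ) :
    XNIndSeries k vtx ρ (SkewMonoidAlgebra.single 1 (BAlg.idem k i)) (t ⊗ₜ z)
      = t ⊗ₜ ((SkewMonoidAlgebra.single 1 (BAlg.idem ℂ i) : BS ℂ I n) • z) := by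
  rw [XNIndSeries, extendScalars_idem]
  rfl

theorem XNIndSeries_of_tmul (σ : Equiv.Perm (Fin n)) (t : k) (z : XNInd vtx ρ) :
    XNIndSeries k vtx ρ (SkewMonoidAlgebra.of _ _ σ) (t ⊗ₜ z)
      = t ⊗ₜ (SkewMonoidAlgebra.of (BAlg ℂ I n) _ σ • z) := by
  rw [XNIndSeries, extendScalars_of]
  rfl

/-- The translate `σ X` sits at the single tuple `i` with `i ∘ σ` equal to the base tuple. -/
theorem XNIndSeries_idem_of_toInd (i : Fin n → I) (t : k) (σ : Equiv.Perm (Fin n))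
    (x : ⨂[ℂ] l, X l) :
    XNIndSeries k vtx ρ (SkewMonoidAlgebra.single 1 (BAlg.idem k i))
        (t ⊗ₜ (SkewMonoidAlgebra.of (BAlg ℂ I n) _ σ • toInd vtx ρ x))
      = if i ∘ σ = baseTuple c vtx then
          t ⊗ₜ (SkewMonoidAlgebra.of (BAlg ℂ I n) _ σ • toInd vtx ρ x) else 0 := by
  rw [XNIndSeries_idem_tmul, smul_smul, single_idem_mul_of, ← smul_smul, single_one_smul_toInd,
    BAlg.idem_apply]
  by_cases h : i ∘ σ = baseTuple c vtx
  · rw [if_pos h, if_pos h.symm, one_smul]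
  · rw [if_neg h, if_neg (Ne.symm h), zero_smul, smul_zero, TensorProduct.tmul_zero]

theorem XNIndSeries_idem_toInd (t : k) (x : ⨂[ℂ] l, X l) :
    XNIndSeries k vtx ρ (SkewMonoidAlgebra.single 1 (BAlg.idem k (baseTuple c vtx)))
        (t ⊗ₜ toInd vtx ρ x) = t ⊗ₜ toInd vtx ρ x := by
  have := XNIndSeries_idem_of_toInd k vtx ρ (baseTuple c vtx) t 1 x
  rwa [map_one, one_smul, Equiv.Perm.coe_one, Function.comp_id, if_pos rfl] at this

omit [Fintype I] [DecidableEq I] in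
theorem series_end_ext {A B : Module.End k (k ⊗[ℂ] XNInd vtx ρ)}
    (h : ∀ (t : k) (σ : Equiv.Perm (Fin n)) (x : ⨂[ℂ] l, X l),
      A (t ⊗ₜ (SkewMonoidAlgebra.of (BAlg ℂ I n) _ σ • toInd vtx ρ x))
        = B (t ⊗ₜ (SkewMonoidAlgebra.of (BAlg ℂ I n) _ σ • toInd vtx ρ x))) : A = B := by
  refine LinearMap.ext fun w => ?_
  induction w using TensorProduct.induction_on with
  | zero => rw [map_zero, map_zero]
  | add w w' hw hw' => rw [map_add, map_add, hw, hw']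
  | tmul t z =>
    induction z using induced_induction with
    | zero => rw [TensorProduct.tmul_zero, map_zero, map_zero]
    | add z w hz hw => rw [TensorProduct.tmul_add, map_add, map_add, hz, hw]
    | of σ x => exact h t σ x

theorem XNIndSeries_idem_eq_zero {i : Fin n → I}
    (hi : ∀ σ : Equiv.Perm (Fin n), i ∘ σ ≠ baseTuple c vtx) :
    XNIndSeries k vtx ρ (SkewMonoidAlgebra.single 1 (BAlg.idem k i)) = 0 := by
  refine series_end_ext k vtx ρ fun t σ x => ?_
  rw [XNIndSeries_idem_of_toInd, if_neg (hi σ), LinearMap.zero_apply]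

/-- All tuples in the support are rearrangements of the base tuple, so each vertex occurs equally
often in them. A move along an edge that is not a loop adds an occurrence of its head. -/
theorem XNIndSeries_idem_eq_zero_or [Quiver.{v} I] (hQ : ∀ i : I, IsEmpty (i ⟶ i)) (l : Fin n)
    (a : DoubleEdge I) (i : Fin n → I) (hl : i l = tail a) :
    XNIndSeries k vtx ρ (SkewMonoidAlgebra.single 1 (BAlg.idem k (move l a i))) = 0 ∨
      XNIndSeries k vtx ρ (SkewMonoidAlgebra.single 1 (BAlg.idem k i)) = 0 := by
  by_contra hcon
  rw [not_or] at hcon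
  obtain ⟨σ, hσ⟩ : ∃ σ : Equiv.Perm (Fin n), move l a i ∘ σ = baseTuple c vtx := by
    by_contra h
    push Not at h
    exact hcon.1 (XNIndSeries_idem_eq_zero k vtx ρ h)
  obtain ⟨τ, hτ⟩ : ∃ σ : Equiv.Perm (Fin n), i ∘ σ = baseTuple c vtx := by
    by_contra h
    push Not at h
    exact hcon.2 (XNIndSeries_idem_eq_zero k vtx ρ h)
  have hne : tail a ≠ head a := by
    intro h
    rcases a with ⟨x, y, e⟩ | ⟨x, y, e⟩
    · change x = y at h
      subst h
      exact (hQ x).false e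
    · change y = x at h
      subst h
      exact (hQ y).false e
  have hcard : ∀ (f : Fin n → I) (π : Equiv.Perm (Fin n)), f ∘ π = baseTuple c vtx →
      (Finset.univ.filter fun m => f m = head a).card
        = (Finset.univ.filter fun m => baseTuple c vtx m = head a).card := by
    intro f π hπ
    symm
    refine Finset.card_equiv π fun m => ?_
    simp only [Finset.mem_filter, Finset.mem_univ, true_and, ← hπ, Function.comp_apply]
  have h1 := (hcard _ σ hσ).trans (hcard _ τ hτ).symm
  have h2 : (Finset.univ.filter fun m => i m = head a)
      ⊂ Finset.univ.filter fun m => move l a i m = head a := by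
    rw [Finset.ssubset_iff_of_subset]
    · refine ⟨l, ?_, ?_⟩
      · exact Finset.mem_filter.mpr ⟨Finset.mem_univ _, Function.update_self _ _ _⟩
      · simpa [hl] using hne
    · intro m hm
      simp only [Finset.mem_filter, Finset.mem_univ, true_and] at hm ⊢
      by_cases h : m = l
      · subst h; exact Function.update_self _ _ _
      · rwa [move, Function.update_of_ne h]
  exact (Finset.card_lt_card h2).ne h1.symm

end Series

/-! ### The two directions of the theorem. -/

section Criterion

variable (k : Type*) [CommRing k] [Algebra ℂ k] {I : Type u} [Quiver.{v} I] [Fintype I]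
  [DecidableEq I] [Fintype (Quiver.Total I)] {n : ℕ}
  {c : Composition n} {X : Fin c.length → Type w}
  [∀ l, AddCommGroup (X l)] [∀ l, Module ℂ (X l)] (vtx : Fin c.length → I)
  (ρ : ∀ l, Representation ℂ (Equiv.Perm (Fin (c.blocksFun l))) (X l))

variable {k vtx ρ}

omit [Quiver.{v} I] [Fintype I] [DecidableEq I] [Fintype (Quiver.Total I)] in
/-- An equation between pure tensors of `k ⊗ X`, tested on a functional of `k`. -/
theorem smul_eq_smul_of_tmul_toInd_eq (f : k →ₗ[ℂ] ℂ) {s t : k} {x y : ⨂[ℂ] l, X l}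
    (h : s ⊗ₜ[ℂ] toInd vtx ρ x = t ⊗ₜ[ℂ] toInd vtx ρ y) : f s • x = f t • y := by
  have := congrArg (fun w => TensorProduct.lid ℂ _ (TensorProduct.map f (retract vtx ρ) w)) h
  simpa only [TensorProduct.map_tmul, TensorProduct.lid_tmul, retract_toInd] using this

omit [Quiver.{v} I] [Fintype I] [DecidableEq I] [Fintype (Quiver.Total I)] in
-- A functional equal to `1` on `x`, composed with the retraction, contracts both sides to elements
-- of `k`.
theorem eq_of_tmul_toInd_eq {s t : k} {x : ⨂[ℂ] l, X l} (hx : x ≠ 0)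
    (h : s ⊗ₜ[ℂ] toInd vtx ρ x = t ⊗ₜ[ℂ] toInd vtx ρ x) : s = t := by
  obtain ⟨g, hg⟩ := Module.Projective.exists_dual_eq_one ℂ hx
  have := congrArg (fun w => TensorProduct.rid ℂ _
    (TensorProduct.map (LinearMap.id : k →ₗ[ℂ] k) (g ∘ₗ retract vtx ρ) w)) h
  simpa [retract_toInd, hg] using this

omit [Quiver.{v} I] [Fintype (Quiver.Total I)] in
/-- The one-factor relation at the base tuple, evaluated on `X ⊗ 𝒩`. -/
theorem base_one_factor (hvtx : Function.Injective vtx) {lam : I → k} {nu : k}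
    (h1 : ∀ (l : Fin n) (i : Fin n → I),
        -(lam (i l) • XNIndSeries k vtx ρ (SkewMonoidAlgebra.single 1 (BAlg.idem k i)))
          = nu • ∑ m with m ≠ l ∧ i m = i l,
            XNIndSeries k vtx ρ (SkewMonoidAlgebra.of _ _ (Equiv.swap l m)) *
              XNIndSeries k vtx ρ (SkewMonoidAlgebra.single 1 (BAlg.idem k i)))
    (p : Fin c.length) (j : Fin (c.blocksFun p)) (x : ⨂[ℂ] l, X l) :
    (-lam (vtx p)) ⊗ₜ[ℂ] toInd vtx ρ x = nu ⊗ₜ[ℂ] toInd vtx ρ (∑ j' ∈ Finset.univ.erase j,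
        tensorRep ρ (Pi.mulSingle p (Equiv.swap j j')) x) := by
  have h := LinearMap.congr_fun (h1 (c.embedding p j) (baseTuple c vtx))
    ((1 : k) ⊗ₜ[ℂ] toInd vtx ρ x)
  simp only [LinearMap.neg_apply, LinearMap.smul_apply, LinearMap.sum_apply, Module.End.mul_apply,
    XNIndSeries_idem_toInd, XNIndSeries_of_tmul, ← TensorProduct.tmul_sum] at h
  rw [sum_block_swaps_smul_toInd ρ vtx hvtx p j x, TensorProduct.smul_tmul',
    TensorProduct.smul_tmul', smul_eq_mul, smul_eq_mul, mul_one, mul_one, ← TensorProduct.neg_tmul,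
    baseTuple, c.index_embedding] at h
  exact h

theorem rectangle_of_extends (hQ : ∀ i : I, IsEmpty (i ⟶ i)) {lam : I → k} {nu : k} (hnu : nu ≠ 0)
    (hρ : ∀ l, (ρ l).IsIrreducible) (hvtx : Function.Injective vtx)
    (h : ExtendsToA lam nu (XNIndSeries k vtx ρ)) :
    (∀ l, ∃ a b : ℕ, HasYoungDiagram (ρ l) (rectangle a b) ∧
      lam (vtx l) = ((a : k) - (b : k)) * nu) ∧
    (∀ p q, p ≠ q → IsEmpty (vtx p ⟶ vtx q)) := by
  obtain ⟨h1, h2⟩ := (extendsToA_iff lam nu _ (XNIndSeries_idem_eq_zero_or k vtx ρ hQ)).mp h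
  -- A `ℂ`-linear functional on `k` with `f nu = 1` turns the relation over `k` into a complex
  -- scalar `-f (lam (vtx p))` for the star sums.
  obtain ⟨f, hf⟩ := Module.Projective.exists_dual_eq_one ℂ hnu
  have hX : ∀ l, ∃ x : X l, x ≠ 0 := fun l => by
    have : IsSimpleModule (MonoidAlgebra ℂ (Equiv.Perm (Fin (c.blocksFun l)))) (ρ l).asModule :=
      (Representation.irreducible_iff_isSimpleModule_asModule (ρ l)).mp (hρ l)
    have : Nontrivial (X l) := IsSimpleModule.nontrivial
      (MonoidAlgebra ℂ (Equiv.Perm (Fin (c.blocksFun l)))) (ρ l).asModule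
    exact exists_ne 0
  choose x hx using hX
  have hpos : ∀ l, 0 < c.blocksFun l := fun l => c.one_le_blocksFun l
  refine ⟨fun p => ?_, fun p q hpq => ⟨fun e => ?_⟩⟩
  · have hJ : ∀ (j : Fin (c.blocksFun p)) (y : X p),
        ∑ j' ∈ Finset.univ.erase j, ρ p (Equiv.swap j j') y = (-f (lam (vtx p))) • y := by
      intro j y
      have h3 := smul_eq_smul_of_tmul_toInd_eq f (base_one_factor hvtx h1 p j
        (PiTensorProduct.tprod ℂ (Function.update x p y)))
      rw [hf, one_smul, sum_tensorRep_swap_tprod, Function.update_self, Function.update_idem,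
        ← MultilinearMap.map_update_smul, map_neg] at h3
      -- A nonzero discrepancy in the factor `p`, tensored with nonzero vectors in the other
      -- factors, would be a nonzero tensor.
      by_contra hne
      have h4 : PiTensorProduct.tprod ℂ (Function.update x p
          (∑ j' ∈ Finset.univ.erase j, ρ p (Equiv.swap j j') y - (-f (lam (vtx p))) • y)) = 0 := by
        rw [MultilinearMap.map_update_sub, ← h3, sub_self]
      refine tprod_ne_zero (fun l => ?_) h4
      by_cases hl : l = p
      · subst hl
        rw [Function.update_self]
        exact sub_ne_zero.mpr hne
      · rw [Function.update_of_ne hl]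
        exact hx l
    obtain ⟨a, b, hab, hc⟩ := exists_hasYoungDiagram_rectangle (hpos p) (hρ p) hJ
    refine ⟨a, b, hab, ?_⟩
    -- The functional `f` retained only part of `lam`; with the scalar now known, the relation is
    -- read again in `k` itself.
    have h3 := base_one_factor hvtx h1 p ⟨0, hpos p⟩ (PiTensorProduct.tprod ℂ x)
    rw [sum_tensorRep_swap_tprod, hJ, hc, MultilinearMap.map_update_smul, Function.update_eq_self,
      map_smul, ← TensorProduct.smul_tmul] at h3
    have h4 := eq_of_tmul_toInd_eq (tprod_ne_zero hx) h3
    rw [Algebra.smul_def, map_sub, map_natCast, map_natCast] at h4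
    linear_combination -h4
  · have h3 := h2 (c.embedding q ⟨0, hpos q⟩) (c.embedding p ⟨0, hpos p⟩)
      (fun h => hpq (by
        have := congrArg c.index h
        rw [c.index_embedding, c.index_embedding] at this
        exact this.symm)) ⟨vtx p, vtx q, e⟩ (baseTuple c vtx)
      (by rw [baseTuple, c.index_embedding]) (by rw [baseTuple, c.index_embedding])
    set s := Equiv.swap (c.embedding q ⟨0, hpos q⟩) (c.embedding p ⟨0, hpos p⟩) with hs
    -- Applying the transposition once more cancels it and leaves `nu ⊗ x = 0` with `x` nonzero.
    have h4 := congrArg (XNIndSeries k vtx ρ (SkewMonoidAlgebra.of _ _ s))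
      (LinearMap.congr_fun h3 ((1 : k) ⊗ₜ[ℂ] toInd vtx ρ (PiTensorProduct.tprod ℂ x)))
    rw [LinearMap.smul_apply, Module.End.mul_apply, XNIndSeries_idem_toInd, map_smul,
      ← Module.End.mul_apply, ← map_mul, ← map_mul, hs, Equiv.swap_mul_self, map_one, map_one,
      Module.End.one_apply, TensorProduct.smul_tmul', smul_eq_mul, mul_one, LinearMap.zero_apply,
      map_zero, ← TensorProduct.zero_tmul k (toInd vtx ρ (PiTensorProduct.tprod ℂ x))] at h4
    exact hnu (eq_of_tmul_toInd_eq (tprod_ne_zero hx) h4)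

omit [Quiver.{v} I] [Fintype I] [DecidableEq I] [Fintype (Quiver.Total I)] in
theorem sum_tensorRep_swap_of_rectangle {p : Fin c.length} {a b : ℕ}
    (h : HasYoungDiagram (ρ p) (rectangle a b)) (j : Fin (c.blocksFun p)) (x : ⨂[ℂ] l, X l) :
    ∑ j' ∈ Finset.univ.erase j, tensorRep ρ (Pi.mulSingle p (Equiv.swap j j')) x
      = ((b : ℂ) - a) • x := by
  have : ∑ j' ∈ Finset.univ.erase j, tensorRep ρ (Pi.mulSingle p (Equiv.swap j j'))
      = ((b : ℂ) - a) • (1 : Module.End ℂ (⨂[ℂ] l, X l)) := by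
    refine PiTensorProduct.ext (MultilinearMap.ext fun y => ?_)
    rw [LinearMap.compMultilinearMap_apply, LinearMap.sum_apply, sum_tensorRep_swap_tprod,
      sum_swap_apply_of_hasYoungDiagram h, MultilinearMap.map_update_smul, Function.update_eq_self]
    rfl
  have h2 := LinearMap.congr_fun this x
  rwa [LinearMap.sum_apply] at h2

theorem extends_of_rectangle (hQ : ∀ i : I, IsEmpty (i ⟶ i)) {lam : I → k} {nu : k}
    (hvtx : Function.Injective vtx) {a b : Fin c.length → ℕ}
    (hY : ∀ l, HasYoungDiagram (ρ l) (rectangle (a l) (b l)))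
    (hE : ∀ p q, p ≠ q → IsEmpty (vtx p ⟶ vtx q))
    (hlam : ∀ l, lam (vtx l) = ((a l : k) - (b l : k)) * nu) :
    ExtendsToA lam nu (XNIndSeries k vtx ρ) := by
  refine (extendsToA_iff lam nu _ (XNIndSeries_idem_eq_zero_or k vtx ρ hQ)).mpr ⟨?_, ?_⟩
  · intro l i
    refine series_end_ext k vtx ρ fun t σ x => ?_
    simp only [LinearMap.neg_apply, LinearMap.smul_apply, LinearMap.sum_apply,
      Module.End.mul_apply, XNIndSeries_idem_of_toInd]
    split_ifs with hi
    swap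
    · simp
    -- Conjugation by `σ` carries the star sum at `l` to the one at `σ⁻¹ l`, which lies in block `p`
    -- of the base tuple.
    obtain ⟨⟨p, j⟩, hl⟩ := c.blocksFinEquiv.surjective (σ.symm l)
    have hl' : σ.symm l = c.embedding p j := hl.symm
    have hval : ∀ m, i m = baseTuple c vtx (σ.symm m) := fun m => by
      rw [← hi, Function.comp_apply, Equiv.apply_symm_apply]
    have hsum : ∑ m with m ≠ l ∧ i m = i l,
          XNIndSeries k vtx ρ (SkewMonoidAlgebra.of _ _ (Equiv.swap l m))
            (t ⊗ₜ (SkewMonoidAlgebra.of (BAlg ℂ I n) _ σ • toInd vtx ρ x))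
        = t ⊗ₜ (SkewMonoidAlgebra.of (BAlg ℂ I n) _ σ • toInd vtx ρ (((b p : ℂ) - a p) • x)) := by
      rw [← sum_tensorRep_swap_of_rectangle (hY p) j x, ← sum_block_swaps_smul_toInd ρ vtx hvtx p j x,
        Finset.smul_sum, TensorProduct.tmul_sum]
      refine Finset.sum_equiv σ.symm ?_ ?_
      · intro m
        simp only [Finset.mem_filter, Finset.mem_univ, true_and, hval, ← hl', ne_eq,
          EmbeddingLike.apply_eq_iff_eq]
      · intro m _
        rw [XNIndSeries_of_tmul, smul_smul, smul_smul, ← map_mul, ← map_mul, ← hl',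
          Equiv.mul_swap_eq_swap_mul, Equiv.apply_symm_apply, Equiv.apply_symm_apply]
    rw [hsum, hval l, hl', baseTuple, c.index_embedding, hlam, map_smul, smul_comm _ ((b p : ℂ) - a p)]
    generalize SkewMonoidAlgebra.of (BAlg ℂ I n) _ σ • toInd vtx ρ x = z
    rw [← TensorProduct.smul_tmul, TensorProduct.smul_tmul', TensorProduct.smul_tmul',
      ← TensorProduct.neg_tmul, smul_eq_mul, smul_eq_mul, Algebra.smul_def, map_sub, map_natCast,
      map_natCast]
    congr 1
    ring
  · intro l m hlm e i hl hm
    refine series_end_ext k vtx ρ fun t σ x => ?_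
    rw [LinearMap.smul_apply, Module.End.mul_apply, XNIndSeries_idem_of_toInd]
    split_ifs with hi
    swap
    · simp
    have hval : ∀ m, i m = vtx (c.index (σ.symm m)) := fun m => by
      change _ = baseTuple c vtx (σ.symm m)
      rw [← hi, Function.comp_apply, Equiv.apply_symm_apply]
    obtain ⟨y, z, e⟩ := e
    change i l = z at hl
    change i m = y at hm
    rw [hval] at hl hm
    subst hl hm
    -- Positions in one block would give a loop of `Q`; positions in different blocks are excluded
    -- by `hE`.
    by_cases hpq : c.index (σ.symm m) = c.index (σ.symm l)
    · rw [hpq] at e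
      exact ((hQ _).false e).elim
    · exact ((hE _ _ hpq).false e).elim

end Criterion

end WreathPreproj

open WreathPreproj in
theorem theorem6p3
    {U : Type*} [AddCommGroup U] [Module ℂ U] [FiniteDimensional ℂ U]
    {I : Type*} [Quiver I] [Fintype I] [DecidableEq I] [Fintype (Quiver.Total I)]
    (hQ : ∀ i : I, IsEmpty (i ⟶ i))
    {n : ℕ} (hn : 0 < n)
    (lam : I → PowerSeriesOn U) (nu : PowerSeriesOn U) (hnu : nu ≠ 0)
    (c : Composition n)
    (X : Fin c.length → Type*) [∀ l, AddCommGroup (X l)] [∀ l, Module ℂ (X l)]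
    (ρ : ∀ l, Representation ℂ (Equiv.Perm (Fin (c.blocksFun l))) (X l))
    (hρ : ∀ l, (ρ l).IsIrreducible)
    (vtx : Fin c.length → I) (hvtx : Function.Injective vtx) :
    ExtendsToA lam nu (XNIndSeries (PowerSeriesOn U) vtx ρ) ↔
      ∃ a b : Fin c.length → ℕ,
        (∀ l, HasYoungDiagram (ρ l) (rectangle (a l) (b l))) ∧
        (∀ p q, p ≠ q → IsEmpty (vtx p ⟶ vtx q)) ∧
        (∀ l, lam (vtx l) = ((a l : PowerSeriesOn U) - (b l : PowerSeriesOn U)) * nu) := by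
  constructor
  · intro h
    obtain ⟨h1, h2⟩ := rectangle_of_extends hQ hnu hρ hvtx h
    choose a b hY hlam using h1
    exact ⟨a, b, hY, h2, hlam⟩
  · rintro ⟨a, b, hY, hE, hlam⟩
    exact extends_of_rectangle hQ hvtx hY hE hlam
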